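/- For $n\ge 1$, let the symmetric group $\mathfrak S_n$ act on $V=\{v\in\mathbb R^n:\sum_i v_i=0\}$ by permuting coordinates, and let $\mathcal L_n$ be its intersection lattice, that is, the set of all intersections of the reflecting hyperplanes $\mathrm{Fix}(t)\subset V$, where $t$ runs over the transpositions (the empty intersection being $V$). For $X\in\mathcal L_n$ let $W_X=\{w\in\mathfrak S_n: X\subset \mathrm{Fix}(w)\}$. Let $\bar{\mathcal P}_n$ be the poset, ordered by inclusion, of all cosets $wW_X$ with $w\in\mathfrak S_n$, $X\in\mathcal L_n$ and $wW_X\neq\mathfrak S_n$, on which $\mathfrak S_n$ acts by left multiplication. Let $\boldsymbol\xi$ be the character of $\mathfrak S_n$ acting on the top reduced homology group $\tilde H_{n-2}(\bar{\mathcal P}_n;\mathbb C)$ of the order complex of $\bar{\mathcal P}_n$, and let $D_n=\dim\boldsymbol\xi=\boldsymbol\xi(1)$ be its dimension. (For $n=1$ the poset is empty and $\tilde H_{-1}(\varnothing;\mathbb C)=\mathbb C$.) For $w\in\mathfrak S_n$ let $\mathrm{des}(w)=\{s\in S:\ell(ws)<\ell(w)\}$, where $S$ is the set of adjacent transpositions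 $(i\ i{+}1)$ and $\ell$ is the Coxeter length, i.e. the least number of factors in an expression of an element as a product of elements of $S$. Then, for every $n\ge 1$, $D_n$ equals the number of pairs $(\sigma,\tau)\in\mathfrak S_n^2$ such that $\tau(1)=1$ and $\mathrm{des}(\sigma)\subseteq\mathrm{des}(\tau)$. Moreover, as formal power series in $x$, $$\sum_{n\ge 1} D_n\frac{x^n}{n!^2}=-\log\big(J_0(2\sqrt x)\big),$$ where $J_0$ is the Bessel function with parameter $0$, so that $J_0(2\sqrt x)=\sum_{n\ge 0}\frac{(-x)^n}{n!^2}$. -/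

import Mathlib

open scoped Pointwise Nat

noncomputable section

namespace ParabolicCosets

/-! ### Reduced homology of the order complex of a poset, with a group action

A `k`-element chain `x₀ < x₁ < ⋯ < x_{k-1}` of a poset `α` is an order embedding `Fin k ↪o α`;
it is a simplex of dimension `k - 1` of the order complex of `α`.
The empty chain (`k = 0`) is included, so that the complex below is the augmented one. -/

section OrderComplex

variable (𝕜 : Type*) [Field 𝕜] (α : Type*) [PartialOrder α]

/-- The space of `(k - 1)`-dimensional chains of the order complex of `α`: the `𝕜`-vector
space with basis the `k`-element chains in `α`. -/
def ChainSpace (k : ℕ) : Type _ := (Fin k ↪o α) →₀ 𝕜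

instance (k : ℕ) : AddCommGroup (ChainSpace 𝕜 α k) :=
  inferInstanceAs (AddCommGroup ((Fin k ↪o α) →₀ 𝕜))

instance (k : ℕ) : Module 𝕜 (ChainSpace 𝕜 α k) :=
  inferInstanceAs (Module 𝕜 ((Fin k ↪o α) →₀ 𝕜))

/-- The basis of the chain space given by the `k`-element chains. -/
def chainBasis (k : ℕ) : Module.Basis (Fin k ↪o α) 𝕜 (ChainSpace 𝕜 α k) :=
  Module.Basis.ofRepr (LinearEquiv.refl 𝕜 ((Fin k ↪o α) →₀ 𝕜))

instance (k : ℕ) [Finite α] : FiniteDimensional 𝕜 (ChainSpace 𝕜 α k) :=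
  have : Finite (Fin k ↪o α) := Finite.of_injective _ RelEmbedding.toEmbedding_injective
  Module.Finite.of_basis (chainBasis 𝕜 α k)

/-- The face of a chain obtained by deleting its `i`-th element. -/
def face {α : Type*} [PartialOrder α] {k : ℕ} (i : Fin (k + 1)) (c : Fin (k + 1) ↪o α) :
    Fin k ↪o α :=
  (Fin.succAboveOrderEmb i).trans c

/-- The simplicial boundary map `c ↦ ∑ i, (-1) ^ i • (c without its i-th element)`; for `k = 0`
it is the augmentation. -/
def boundary (k : ℕ) : ChainSpace 𝕜 α (k + 1) →ₗ[𝕜] ChainSpace 𝕜 α k :=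
  (chainBasis 𝕜 α (k + 1)).constr 𝕜 fun c =>
    ∑ i : Fin (k + 1), (-1 : 𝕜) ^ (i : ℕ) • chainBasis 𝕜 α k (face i c)

/-- Reduced cycles of dimension `k - 1`; everything is a cycle in the lowest dimension `-1`. -/
def cycles : (k : ℕ) → Submodule 𝕜 (ChainSpace 𝕜 α k)
  | 0 => ⊤
  | k + 1 => LinearMap.ker (boundary 𝕜 α k)

/-- The boundaries of dimension `k - 1`, as a subspace of the space of cycles. -/
def boundariesInCycles (k : ℕ) : Submodule 𝕜 (cycles 𝕜 α k) :=
  (LinearMap.range (boundary 𝕜 α k)).submoduleOf (cycles 𝕜 α k)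

/-- The reduced homology group `H̃_{k-1}` with coefficients in `𝕜` of the order complex of `α`. -/
abbrev ReducedHomology (k : ℕ) : Type _ := cycles 𝕜 α k ⧸ boundariesInCycles 𝕜 α k

/-- The boundary of a boundary vanishes. -/
theorem boundary_boundary (k : ℕ) : boundary 𝕜 α k ∘ₗ boundary 𝕜 α (k + 1) = 0 := by
  refine (chainBasis 𝕜 α (k + 2)).ext fun c => ?_
  simp only [boundary, LinearMap.comp_apply, Module.Basis.constr_basis, map_sum, map_smul,
    LinearMap.zero_apply]
  simp only [Finset.smul_sum, smul_smul, ← pow_add]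
  rw [← Finset.sum_product']
  refine Finset.sum_involution (fun p _ => (p.1.succAbove p.2, p.2.predAbove p.1)) ?_ ?_ ?_ ?_
  · rintro ⟨i, j⟩ -
    have h : face (j.predAbove i) (face (i.succAbove j) c) = face j (face i c) :=
      RelEmbedding.ext fun a => congrArg c (Fin.succAbove_succAbove_succAbove_predAbove i j a)
    simp only [h, Fin.neg_one_pow_succAbove_add_predAbove, neg_smul, add_neg_cancel]
  · rintro ⟨i, j⟩ - - h
    exact Fin.succAbove_ne i j (congrArg Prod.fst h)
  · intro p _
    simp
  · rintro ⟨i, j⟩ -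
    simp only [Fin.succAbove_succAbove_predAbove, Fin.predAbove_predAbove_succAbove]

/-- Boundaries are cycles. -/
theorem range_boundary_le_cycles (k : ℕ) : LinearMap.range (boundary 𝕜 α k) ≤ cycles 𝕜 α k := by
  cases k with
  | zero => exact le_top
  | succ k => exact LinearMap.range_le_ker_iff.2 (boundary_boundary 𝕜 α k)

variable {α} {G : Type*} [Group G] (ρ : G →* (α ≃o α))

/-- The representation of `G` on chains induced by an action by poset automorphisms:
`g` sends `x₀ < ⋯ < x_{k-1}` to `g x₀ < ⋯ < g x_{k-1}`. -/
def chainRep (k : ℕ) : Representation 𝕜 G (ChainSpace 𝕜 α k) where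
  toFun g := (chainBasis 𝕜 α k).constr 𝕜 fun c =>
    chainBasis 𝕜 α k (c.trans (ρ g).toOrderEmbedding)
  map_one' := by
    refine (chainBasis 𝕜 α k).ext fun c => ?_
    simp only [Module.Basis.constr_basis, map_one]
    rfl
  map_mul' g h := by
    refine (chainBasis 𝕜 α k).ext fun c => ?_
    simp only [Module.Basis.constr_basis, map_mul, Module.End.mul_apply]
    rfl

/-- The boundary map commutes with the action. -/
theorem boundary_chainRep (k : ℕ) (g : G) :
    boundary 𝕜 α k ∘ₗ chainRep 𝕜 ρ (k + 1) g = chainRep 𝕜 ρ k g ∘ₗ boundary 𝕜 α k := by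
  refine (chainBasis 𝕜 α (k + 1)).ext fun c => ?_
  simp only [boundary, chainRep, LinearMap.comp_apply, MonoidHom.coe_mk, OneHom.coe_mk,
    Module.Basis.constr_basis, map_sum, map_smul]
  rfl

theorem cycles_le_comap (k : ℕ) (g : G) :
    cycles 𝕜 α k ≤ (cycles 𝕜 α k).comap (chainRep 𝕜 ρ k g) := by
  cases k with
  | zero => exact le_top
  | succ k =>
    intro x hx
    have h := LinearMap.congr_fun (boundary_chainRep 𝕜 ρ k g) x
    simp only [cycles, LinearMap.mem_ker, Submodule.mem_comap, LinearMap.comp_apply] at hx h ⊢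
    rw [h, hx, map_zero]

/-- The representation on cycles. -/
def cyclesRep (k : ℕ) : Representation 𝕜 G (cycles 𝕜 α k) :=
  (chainRep 𝕜 ρ k).subrepresentation (cycles 𝕜 α k) (cycles_le_comap 𝕜 ρ k)

theorem boundaries_le_comap (k : ℕ) (g : G) :
    boundariesInCycles 𝕜 α k ≤ (boundariesInCycles 𝕜 α k).comap (cyclesRep 𝕜 ρ k g) := by
  rintro x ⟨y, hy⟩
  exact ⟨chainRep 𝕜 ρ (k + 1) g y,
    (LinearMap.congr_fun (boundary_chainRep 𝕜 ρ k g) y).trans (congrArg (chainRep 𝕜 ρ k g) hy)⟩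

/-- The representation of `G` on the reduced homology group `H̃_{k-1}` of the order complex. -/
def homologyRep (k : ℕ) : Representation 𝕜 G (ReducedHomology 𝕜 α k) :=
  (cyclesRep 𝕜 ρ k).quotient (boundariesInCycles 𝕜 α k) (boundaries_le_comap 𝕜 ρ k)

end OrderComplex

/-! ### The parabolic coset poset of the symmetric group -/

/-- The space `V = {v ∈ ℝⁿ : ∑ v_i = 0}`. -/
def sumZero (n : ℕ) : Submodule ℝ (Fin n → ℝ) :=
  LinearMap.ker (∑ i : Fin n, (LinearMap.proj i : (Fin n → ℝ) →ₗ[ℝ] ℝ))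

/-- The action of the symmetric group on `ℝⁿ`: `(σ v)_i = v_{σ⁻¹ i}`. -/
def permRep (n : ℕ) : Representation ℝ (Equiv.Perm (Fin n)) (Fin n → ℝ) where
  toFun σ := LinearMap.funLeft ℝ ℝ ⇑σ⁻¹
  map_one' := rfl
  map_mul' σ τ := by
    ext v i
    simp [LinearMap.funLeft_apply, mul_inv_rev]

theorem sumZero_le_comap (n : ℕ) (σ : Equiv.Perm (Fin n)) :
    sumZero n ≤ (sumZero n).comap (permRep n σ) := by
  intro v hv
  simp only [sumZero, permRep, Submodule.mem_comap, LinearMap.mem_ker, LinearMap.sum_apply,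
    LinearMap.proj_apply, MonoidHom.coe_mk] at hv ⊢
  rw [← hv]
  exact Equiv.sum_comp σ⁻¹ v

/-- The geometric representation of the symmetric group, on `V`. -/
def geomRep (n : ℕ) : Representation ℝ (Equiv.Perm (Fin n)) (sumZero n) :=
  (permRep n).subrepresentation (sumZero n) (sumZero_le_comap n)

/-- `Fix(σ)`, the space of vectors of `V` fixed by `σ`. -/
def fixedSpace {n : ℕ} (σ : Equiv.Perm (Fin n)) : Submodule ℝ (sumZero n) :=
  LinearMap.ker (geomRep n σ - LinearMap.id)

/-- The intersection lattice: all intersections of reflecting hyperplanes, where the reflections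
of the symmetric group are the transpositions. The empty intersection is `V`. -/
def intersectionLattice (n : ℕ) : Set (Submodule ℝ (sumZero n)) :=
  {X | ∃ T : Set (Equiv.Perm (Fin n)), (∀ t ∈ T, t.IsSwap) ∧ X = ⨅ t ∈ T, fixedSpace t}

/-- The subgroup `W_X` of all `σ` with `X ⊆ Fix(σ)`; it is parabolic if `X` belongs to the
intersection lattice. -/
def fixer {n : ℕ} (X : Submodule ℝ (sumZero n)) : Subgroup (Equiv.Perm (Fin n)) where
  carrier := {σ | X ≤ fixedSpace σ}
  one_mem' := by
    intro v _
    simp [fixedSpace]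
  mul_mem' := by
    intro σ τ hσ hτ v hv
    have h₁ := hσ hv
    have h₂ := hτ hv
    simp only [fixedSpace, LinearMap.mem_ker, LinearMap.sub_apply, LinearMap.id_apply,
      sub_eq_zero, map_mul, Module.End.mul_apply] at h₁ h₂ ⊢
    rw [h₂, h₁]
  inv_mem' := by
    intro σ hσ v hv
    have h₁ := hσ hv
    simp only [fixedSpace, LinearMap.mem_ker, LinearMap.sub_apply, LinearMap.id_apply,
      sub_eq_zero] at h₁ ⊢
    conv_lhs => rw [← h₁]
    rw [← Module.End.mul_apply, ← map_mul, inv_mul_cancel, map_one, Module.End.one_apply]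

/-- The parabolic cosets `w W_X`, with `w` in the symmetric group and `X` in the intersection
lattice. -/
def parabolicCosets (n : ℕ) : Set (Set (Equiv.Perm (Fin n))) :=
  {C | ∃ w : Equiv.Perm (Fin n), ∃ X ∈ intersectionLattice n,
    C = w • (fixer X : Set (Equiv.Perm (Fin n)))}

/-- The proper part of the parabolic coset poset: all parabolic cosets except the whole group,
ordered by inclusion. -/
abbrev ProperParabolicCoset (n : ℕ) : Type :=
  {C : Set (Equiv.Perm (Fin n)) // C ∈ parabolicCosets n ∧ C ≠ Set.univ}

theorem smul_mem_proper {n : ℕ} (g : Equiv.Perm (Fin n)) {C : Set (Equiv.Perm (Fin n))}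
    (hC : C ∈ parabolicCosets n ∧ C ≠ Set.univ) :
    g • C ∈ parabolicCosets n ∧ g • C ≠ Set.univ := by
  obtain ⟨⟨w, X, hX, rfl⟩, hne⟩ := hC
  refine ⟨⟨g * w, X, hX, (mul_smul g w _).symm⟩, fun h => hne ?_⟩
  rw [smul_eq_iff_eq_inv_smul] at h
  rw [h, Set.smul_set_univ]

/-- The action of the symmetric group by left multiplication on the proper part of the parabolic
coset poset. -/
def leftAction (n : ℕ) :
    Equiv.Perm (Fin n) →* (ProperParabolicCoset n ≃o ProperParabolicCoset n) where
  toFun g :=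
    { toFun := fun C => ⟨g • C.1, smul_mem_proper g C.2⟩
      invFun := fun C => ⟨g⁻¹ • C.1, smul_mem_proper g⁻¹ C.2⟩
      left_inv := fun C => Subtype.ext (inv_smul_smul g C.1)
      right_inv := fun C => Subtype.ext (smul_inv_smul g C.1)
      map_rel_iff' := Set.smul_set_subset_smul_set_iff }
  map_one' := by
    refine RelIso.ext fun C => ?_
    exact Subtype.ext (one_smul _ C.1)
  map_mul' g h := by
    refine RelIso.ext fun C => ?_
    exact Subtype.ext (mul_smul g h C.1)

/-- The character `ξ` of the symmetric group on `n ≥ 1` letters, whose rank is `n - 1`, acting on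
the top reduced homology group `H̃_{n-2}` of the proper part of the parabolic coset poset. -/
def xi (n : ℕ) : Equiv.Perm (Fin n) → ℂ :=
  (homologyRep ℂ (leftAction n) (n - 1)).character

/-- The dimension (value at the identity) of the character `ξ`. -/
def dimXi (n : ℕ) : ℂ := xi n 1

/-- `dimXi` is the dimension of the top reduced homology group. -/
theorem dimXi_eq_finrank (n : ℕ) :
    dimXi n = Module.finrank ℂ (ReducedHomology ℂ (ProperParabolicCoset n) (n - 1)) :=
  Representation.char_one _

/-! ### Descents -/

/-- The simple reflections of the symmetric group: the adjacent transpositions `(i, i+1)`. -/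
def simpleReflections (n : ℕ) : Set (Equiv.Perm (Fin n)) :=
  {s | ∃ i j : Fin n, (j : ℕ) = i + 1 ∧ s = Equiv.swap i j}

/-- The Coxeter length: the least length of a word in the simple reflections with product `w`. -/
def length {n : ℕ} (w : Equiv.Perm (Fin n)) : ℕ :=
  sInf {k | ∃ l : List (Equiv.Perm (Fin n)),
    (∀ s ∈ l, s ∈ simpleReflections n) ∧ l.prod = w ∧ l.length = k}

/-- The descent set of `w`. -/
def des {n : ℕ} (w : Equiv.Perm (Fin n)) : Set (Equiv.Perm (Fin n)) :=
  {s ∈ simpleReflections n | length (w * s) < length w}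

/-! ### The Bessel function -/

/-- `J₀(2√x) = ∑ (-x)ⁿ / n!²`, as a formal power series in `x`. -/
def besselJZeroTwoSqrt : PowerSeries ℂ :=
  PowerSeries.mk fun n => (-1 : ℂ) ^ n / (n ! : ℂ) ^ 2

/-- The formal power series `∑_{n ≥ 1} D_n xⁿ / n!²`, where `D_n = dimXi n`. -/
def dimSeries : PowerSeries ℂ :=
  PowerSeries.mk fun n => if n = 0 then 0 else dimXi n / (n ! : ℂ) ^ 2

end ParabolicCosets

end

/-!
# The parabolic coset poset of the symmetric group

A parabolic coset `C = w H` other than the whole group determines a pair of sets `(H 0, w H 0)`: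
the block containing `0` of the set partition belonging to `H`, and its image. Such a pair `(A, B)`
consists of two subsets of the same size, with `0 ∈ A` and `A` proper; these pairs form a poset
`MatchedPair n` under inclusion. In the other direction, a nonempty chain `f` of pairs gives the
coset `chainCoset f` of all permutations that map `A` to `B` for each `(A, B)` in `f`.

The map from cosets to pairs is an isomorphism in homology. Its inverse `liftChain` sends a chain
`f` of pairs to the cone with apex `chainCoset f` over the image of the boundary of `f`. One
composite is the identity because the pair of `chainCoset f` is the minimum of `f`. The other is
homotopic to the identity because both a chain `c` and its image lie in the cone of elements above
the minimum of `c`. This is `finrank_reducedHomology_eq`, for posets in general.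

A chain of pairs is a pair of flags with the same dimensions, so that `MatchedPair n` is close to
the Segre product of two Boolean lattices, and its chains are matched as in a lexicographic
shelling. A toggle of a chain `s` is a pair `q`, comparable to all members of `s`, such that adding
`q` to `s` or removing it from `s` does not change the inversions of `s` (with respect to the
increasing order for first components, and to the decreasing order for second ones). Toggling one
of them does not alter the set of toggles, so that a choice of a toggle for each possible set of
toggles gives an involution on the chains which have any. The number of inversions makes the corresponding minors of the boundary maps triangular,
which bounds the ranks from below (`IsInversionSystem.card_downChains_le`); since the bounds add up
to the dimensions of the chain spaces in all degrees but the top one, they are attained. Hence the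
top homology has a dimension equal to the number of chains without toggles. These are maximal
chains, hence come from pairs of permutations `(σ, τ)` with `τ 0 = 0`, such that no position is both an
ascent of `τ` and a descent of `σ` (`card_criticalChains`). As the Coxeter length is the number of
inversions, this means `des σ ⊆ des τ`.

The same count shows that the dimension is, up to sign, the Euler characteristic of `MatchedPair n`.
Sorting chains by their maximum yields a recursion with products of two binomial coefficients
(`chainSum_pairsBelow`), which is the coefficientwise form of `J * D' = -J'`, where `D` is the
generating function of the dimensions and `J` the Bessel series.
-/

open scoped Pointwise Nat

namespace ParabolicCosets

/-! ### Cones in the order complex -/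

section Cone

variable {α : Type*} [PartialOrder α]

/-- The chain `x < c₀ < ⋯ < c_{k-1}`. -/
def consChain {k : ℕ} (x : α) (c : Fin k ↪o α) (h : ∀ i, x < c i) : Fin (k + 1) ↪o α :=
  OrderEmbedding.ofStrictMono (Fin.cons x c) (Fin.strictMono_iff_lt_succ.2 fun i => by
    cases k with
    | zero => exact i.elim0
    | succ k =>
      refine Fin.cases ?_ (fun j => ?_) i
      · simpa using h 0
      · rw [← Fin.succ_castSucc, Fin.cons_succ, Fin.cons_succ]
        exact c.strictMono Fin.castSucc_lt_succ)

@[simp] theorem consChain_zero {k : ℕ} (x : α) (c : Fin k ↪o α) (h : ∀ i, x < c i) :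
    consChain x c h 0 = x := rfl

@[simp] theorem consChain_succ {k : ℕ} (x : α) (c : Fin k ↪o α) (h : ∀ i, x < c i) (i : Fin k) :
    consChain x c h i.succ = c i := rfl

theorem face_apply {k : ℕ} (i : Fin (k + 1)) (c : Fin (k + 1) ↪o α) (j : Fin k) :
    face i c j = c (i.succAbove j) := rfl

@[simp] theorem face_zero_consChain {k : ℕ} (x : α) (c : Fin k ↪o α) (h : ∀ i, x < c i) :
    face 0 (consChain x c h) = c := by
  ext i; simp [face_apply]

theorem face_succ_consChain {k : ℕ} (x : α) (c : Fin (k + 1) ↪o α) (h : ∀ i, x < c i)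
    (i : Fin (k + 1)) :
    face i.succ (consChain x c h) =
      consChain x (face i c) (fun j => by rw [face_apply]; exact h _) := by
  ext j
  refine Fin.cases ?_ (fun j => ?_) j
  · rw [face_apply, Fin.succ_succAbove_zero, consChain_zero, consChain_zero]
  · rw [face_apply, Fin.succ_succAbove_succ, consChain_succ, consChain_succ, face_apply]

theorem lt_face_zero {k : ℕ} (c : Fin (k + 1) ↪o α) (i : Fin k) : c 0 < face 0 c i :=
  c.strictMono (by simp)

@[simp] theorem consChain_face_zero {k : ℕ} (c : Fin (k + 1) ↪o α) (h : ∀ i, c 0 < face 0 c i) :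
    consChain (c 0) (face 0 c) h = c := by
  ext j
  refine Fin.cases ?_ (fun j => ?_) j <;> simp [face_apply]

variable (𝕜 : Type*) [Field 𝕜]

theorem boundary_basis {k : ℕ} (c : Fin (k + 1) ↪o α) :
    boundary 𝕜 α k (chainBasis 𝕜 α (k + 1) c) =
      ∑ i : Fin (k + 1), (-1 : 𝕜) ^ (i : ℕ) • chainBasis 𝕜 α k (face i c) := by
  simp [boundary]

open Classical in
/-- The operator prepending `x` to a chain. Chains whose elements do not all lie above `x` are
sent to zero. -/
noncomputable def cone (x : α) (k : ℕ) : ChainSpace 𝕜 α k →ₗ[𝕜] ChainSpace 𝕜 α (k + 1) :=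
  (chainBasis 𝕜 α k).constr 𝕜 fun c =>
    if h : ∀ i, x < c i then chainBasis 𝕜 α (k + 1) (consChain x c h) else 0

theorem cone_basis_of_lt {x : α} {k : ℕ} (c : Fin k ↪o α) (h : ∀ i, x < c i) :
    cone 𝕜 x k (chainBasis 𝕜 α k c) = chainBasis 𝕜 α (k + 1) (consChain x c h) := by
  simp [cone, h]

theorem cone_basis_of_not_lt {x : α} {k : ℕ} (c : Fin k ↪o α) (h : ¬ ∀ i, x < c i) :
    cone 𝕜 x k (chainBasis 𝕜 α k c) = 0 := by
  rw [cone, Module.Basis.constr_basis, dif_neg h]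

theorem basis_eq_cone {k : ℕ} (c : Fin (k + 1) ↪o α) :
    chainBasis 𝕜 α (k + 1) c = cone 𝕜 (c 0) k (chainBasis 𝕜 α k (face 0 c)) := by
  rw [cone_basis_of_lt 𝕜 _ (lt_face_zero c), consChain_face_zero]

theorem cone_cone (x : α) (k : ℕ) (z : ChainSpace 𝕜 α k) :
    cone 𝕜 x (k + 1) (cone 𝕜 x k z) = 0 := by
  refine LinearMap.congr_fun (f := cone 𝕜 x (k + 1) ∘ₗ cone 𝕜 x k) (g := 0)
    ((chainBasis 𝕜 α k).ext fun c => ?_) z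
  by_cases h : ∀ i, x < c i
  · rw [LinearMap.comp_apply, cone_basis_of_lt 𝕜 c h, cone_basis_of_not_lt]
    · rfl
    · exact fun h' => (h' 0).ne rfl
  · rw [LinearMap.comp_apply, cone_basis_of_not_lt 𝕜 c h, map_zero]
    rfl

/-- The span of the chains all of whose elements are at least `x`. -/
noncomputable def above (x : α) (k : ℕ) : Submodule 𝕜 (ChainSpace 𝕜 α k) :=
  Submodule.span 𝕜 (chainBasis 𝕜 α k '' {c | ∀ i, x ≤ c i})

variable {𝕜}

theorem basis_mem_above {x : α} {k : ℕ} {c : Fin k ↪o α} (h : ∀ i, x ≤ c i) :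
    chainBasis 𝕜 α k c ∈ above 𝕜 x k :=
  Submodule.subset_span ⟨c, h, rfl⟩

theorem above_anti {x y : α} (h : x ≤ y) (k : ℕ) : above 𝕜 y k ≤ above 𝕜 x k :=
  Submodule.span_mono (Set.image_mono fun _ hc i => h.trans (hc i))

/-- A linear map sends `above x` into a submodule as soon as it does so on chains. -/
theorem map_mem_of_mem_above {x : α} {k : ℕ} {M : Type*} [AddCommGroup M] [Module 𝕜 M]
    (f : ChainSpace 𝕜 α k →ₗ[𝕜] M) (N : Submodule 𝕜 M)
    (h : ∀ c : Fin k ↪o α, (∀ i, x ≤ c i) → f (chainBasis 𝕜 α k c) ∈ N)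
    {z : ChainSpace 𝕜 α k} (hz : z ∈ above 𝕜 x k) : f z ∈ N := by
  have : above 𝕜 x k ≤ N.comap f := by
    refine Submodule.span_le.2 ?_
    rintro _ ⟨c, hc, rfl⟩
    exact h c hc
  exact this hz

/-- Two linear maps agree on `above x` as soon as they do so on chains. -/
theorem eq_of_mem_above {x : α} {k : ℕ} {M : Type*} [AddCommGroup M] [Module 𝕜 M]
    (f g : ChainSpace 𝕜 α k →ₗ[𝕜] M)
    (h : ∀ c : Fin k ↪o α, (∀ i, x ≤ c i) → f (chainBasis 𝕜 α k c) = g (chainBasis 𝕜 α k c))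
    {z : ChainSpace 𝕜 α k} (hz : z ∈ above 𝕜 x k) : f z = g z := by
  have := map_mem_of_mem_above (f - g) ⊥ (fun c hc => by simp [h c hc]) hz
  simpa [sub_eq_zero] using this

theorem cone_mem_above {x : α} {k : ℕ} {z : ChainSpace 𝕜 α k} (hz : z ∈ above 𝕜 x k) :
    cone 𝕜 x k z ∈ above 𝕜 x (k + 1) := by
  refine map_mem_of_mem_above _ _ (fun c _ => ?_) hz
  by_cases h : ∀ i, x < c i
  · rw [cone_basis_of_lt 𝕜 c h]
    exact basis_mem_above (Fin.cases le_rfl fun i => (h i).le)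
  · rw [cone_basis_of_not_lt 𝕜 c h]
    exact zero_mem _

theorem boundary_mem_above {x : α} {k : ℕ} {z : ChainSpace 𝕜 α (k + 1)}
    (hz : z ∈ above 𝕜 x (k + 1)) : boundary 𝕜 α k z ∈ above 𝕜 x k := by
  refine map_mem_of_mem_above _ _ (fun c hc => ?_) hz
  rw [boundary_basis]
  exact Submodule.sum_mem _ fun i _ => Submodule.smul_mem _ _ (basis_mem_above fun j => hc _)

theorem mem_above_zero (x : α) (z : ChainSpace 𝕜 α 0) : z ∈ above 𝕜 x 0 := by
  have h : {c : Fin 0 ↪o α | ∀ i, x ≤ c i} = Set.univ :=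
    Set.eq_univ_of_forall fun c i => i.elim0
  rw [above, h, Set.image_univ, Module.Basis.span_eq]
  trivial

/-- Over a vertex, the cone operator contracts the augmentation. -/
theorem boundary_cone_zero (x : α) (z : ChainSpace 𝕜 α 0) :
    boundary 𝕜 α 0 (cone 𝕜 x 0 z) = z := by
  refine LinearMap.congr_fun (f := boundary 𝕜 α 0 ∘ₗ cone 𝕜 x 0) (g := LinearMap.id)
    ((chainBasis 𝕜 α 0).ext fun c => ?_) z
  rw [LinearMap.comp_apply, cone_basis_of_lt 𝕜 c (fun i => i.elim0), boundary_basis]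
  simp

/-- The cone operator is a contracting homotopy of the chains above `x`. -/
theorem boundary_cone {x : α} {k : ℕ} {z : ChainSpace 𝕜 α (k + 1)}
    (hz : z ∈ above 𝕜 x (k + 1)) :
    boundary 𝕜 α (k + 1) (cone 𝕜 x (k + 1) z) = z - cone 𝕜 x k (boundary 𝕜 α k z) := by
  refine eq_of_mem_above (boundary 𝕜 α (k + 1) ∘ₗ cone 𝕜 x (k + 1))
    (LinearMap.id - cone 𝕜 x k ∘ₗ boundary 𝕜 α k) (fun c hc => ?_) hz
  simp only [LinearMap.comp_apply, LinearMap.sub_apply, LinearMap.id_apply]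
  by_cases h : ∀ i, x < c i
  · rw [cone_basis_of_lt 𝕜 c h, boundary_basis, boundary_basis, Fin.sum_univ_succ,
      face_zero_consChain, sub_eq_add_neg, map_sum, ← Finset.sum_neg_distrib]
    congr 1
    · simp
    · refine Finset.sum_congr rfl fun i _ => ?_
      rw [face_succ_consChain, map_smul, cone_basis_of_lt 𝕜 (face i c) (fun j => h _)]
      simp [pow_succ]
  · have h0 : c 0 = x := by
      by_contra hne
      exact h fun i => lt_of_lt_of_le (lt_of_le_of_ne (hc 0) (Ne.symm hne))
        (c.monotone (Fin.zero_le i))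
    rw [cone_basis_of_not_lt 𝕜 c h, map_zero, boundary_basis, Fin.sum_univ_succ, map_add,
      map_sum, Finset.sum_eq_zero, add_zero]
    · rw [← h0]
      simp [← basis_eq_cone]
    · intro i _
      rw [map_smul, cone_basis_of_not_lt, smul_zero]
      intro h'
      cases k with
      | zero => exact i.elim0
      | succ k => exact (h' 0).ne (by rw [face_apply]; simp [h0])

/-- The boundary of a chain with first element `x` consists of the remaining chain and of a
cone over `x`. -/
theorem boundary_basis_eq {k : ℕ} (c : Fin (k + 2) ↪o α) :
    boundary 𝕜 α (k + 1) (chainBasis 𝕜 α (k + 2) c) =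
      chainBasis 𝕜 α (k + 1) (face 0 c) -
        cone 𝕜 (c 0) k (boundary 𝕜 α k (chainBasis 𝕜 α (k + 1) (face 0 c))) := by
  rw [basis_eq_cone 𝕜 c, boundary_cone (basis_mem_above fun i => (lt_face_zero c i).le)]

end Cone

/-! ### Comparing the homology of two posets -/

section Comparison

variable (𝕜 : Type*) [Field 𝕜] {P Q : Type*} [PartialOrder P] [PartialOrder Q]

theorem cone_boundary_basis {k : ℕ} (f : Fin (k + 1) ↪o Q) :
    cone 𝕜 (f 0) k (boundary 𝕜 Q k (chainBasis 𝕜 Q (k + 1) f)) = chainBasis 𝕜 Q (k + 1) f := by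
  cases k with
  | zero => simp [boundary_basis, ← basis_eq_cone]
  | succ k => rw [boundary_basis_eq, map_sub, cone_cone, sub_zero, ← basis_eq_cone]

/-- The chain map induced by a monotone map `a`. It sends `c` to `a ∘ c` if `a ∘ c` is strictly
increasing, and to zero otherwise. -/
noncomputable def pushChain (a : P →o Q) : (k : ℕ) → ChainSpace 𝕜 P k →ₗ[𝕜] ChainSpace 𝕜 Q k
  | 0 => (chainBasis 𝕜 P 0).constr 𝕜 fun _ => chainBasis 𝕜 Q 0 (OrderEmbedding.ofIsEmpty)
  | k + 1 => (chainBasis 𝕜 P (k + 1)).constr 𝕜 fun c =>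
      cone 𝕜 (a (c 0)) k (pushChain a k (chainBasis 𝕜 P k (face 0 c)))

/-- The chain map which sends a chain `f` to the cone with apex `b f` over the image of the
boundary of `f`: for `f` with `k + 1` elements this is the signed sum, over all saturated
sequences of subchains of `f`, of the corresponding chains of values of `b`. -/
noncomputable def liftChain (b : ∀ k, (Fin (k + 1) ↪o Q) → P) :
    (k : ℕ) → ChainSpace 𝕜 Q k →ₗ[𝕜] ChainSpace 𝕜 P k
  | 0 => (chainBasis 𝕜 Q 0).constr 𝕜 fun _ => chainBasis 𝕜 P 0 (OrderEmbedding.ofIsEmpty)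
  | k + 1 => (chainBasis 𝕜 Q (k + 1)).constr 𝕜 fun f =>
      cone 𝕜 (b k f) k (liftChain b k (boundary 𝕜 Q k (chainBasis 𝕜 Q (k + 1) f)))

/-- The chain homotopy between the identity and `liftChain ∘ pushChain`, obtained from the
acyclic carrier which sends a chain `c` to the cone of all elements above the minimum of `c`. -/
noncomputable def chainHomotopy (a : P →o Q) (b : ∀ k, (Fin (k + 1) ↪o Q) → P) :
    (k : ℕ) → ChainSpace 𝕜 P k →ₗ[𝕜] ChainSpace 𝕜 P (k + 1)
  | 0 => 0
  | k + 1 => (chainBasis 𝕜 P (k + 1)).constr 𝕜 fun c =>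
      cone 𝕜 (c 0) (k + 1) (chainBasis 𝕜 P (k + 1) c
        - liftChain 𝕜 b (k + 1) (pushChain 𝕜 a (k + 1) (chainBasis 𝕜 P (k + 1) c))
        - chainHomotopy a b k (boundary 𝕜 P k (chainBasis 𝕜 P (k + 1) c)))

variable (a : P →o Q) (b : ∀ k, (Fin (k + 1) ↪o Q) → P)

theorem pushChain_basis_succ {k : ℕ} (c : Fin (k + 1) ↪o P) :
    pushChain 𝕜 a (k + 1) (chainBasis 𝕜 P (k + 1) c) =
      cone 𝕜 (a (c 0)) k (pushChain 𝕜 a k (chainBasis 𝕜 P k (face 0 c))) := by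
  rw [pushChain, Module.Basis.constr_basis]

theorem liftChain_basis_succ {k : ℕ} (f : Fin (k + 1) ↪o Q) :
    liftChain 𝕜 b (k + 1) (chainBasis 𝕜 Q (k + 1) f) =
      cone 𝕜 (b k f) k (liftChain 𝕜 b k (boundary 𝕜 Q k (chainBasis 𝕜 Q (k + 1) f))) := by
  rw [liftChain, Module.Basis.constr_basis]

theorem chainHomotopy_basis_succ {k : ℕ} (c : Fin (k + 1) ↪o P) :
    chainHomotopy 𝕜 a b (k + 1) (chainBasis 𝕜 P (k + 1) c) =
      cone 𝕜 (c 0) (k + 1) (chainBasis 𝕜 P (k + 1) c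
        - liftChain 𝕜 b (k + 1) (pushChain 𝕜 a (k + 1) (chainBasis 𝕜 P (k + 1) c))
        - chainHomotopy 𝕜 a b k (boundary 𝕜 P k (chainBasis 𝕜 P (k + 1) c))) := by
  rw [chainHomotopy, Module.Basis.constr_basis]

variable {𝕜}

theorem pushChain_mem_above {x : P} {k : ℕ} {z : ChainSpace 𝕜 P k} (hz : z ∈ above 𝕜 x k) :
    pushChain 𝕜 a k z ∈ above 𝕜 (a x) k := by
  induction k generalizing x with
  | zero => exact mem_above_zero _ _
  | succ k ih =>
    refine map_mem_of_mem_above _ _ (fun c hc => ?_) hz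
    rw [pushChain_basis_succ]
    exact above_anti (a.monotone (hc 0)) _
      (cone_mem_above (ih (basis_mem_above fun i => (lt_face_zero c i).le)))

theorem pushChain_cone {x : P} {k : ℕ} {z : ChainSpace 𝕜 P k} (hz : z ∈ above 𝕜 x k) :
    pushChain 𝕜 a (k + 1) (cone 𝕜 x k z) = cone 𝕜 (a x) k (pushChain 𝕜 a k z) := by
  refine eq_of_mem_above (pushChain 𝕜 a (k + 1) ∘ₗ cone 𝕜 x k)
    (cone 𝕜 (a x) k ∘ₗ pushChain 𝕜 a k) (fun c hc => ?_) hz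
  simp only [LinearMap.comp_apply]
  by_cases h : ∀ i, x < c i
  · rw [cone_basis_of_lt 𝕜 c h, pushChain_basis_succ, face_zero_consChain, consChain_zero]
  · cases k with
    | zero => exact absurd (fun i => i.elim0) h
    | succ k =>
      have h0 : c 0 = x := by
        by_contra hne
        exact h fun i => lt_of_lt_of_le (lt_of_le_of_ne (hc 0) (Ne.symm hne))
          (c.monotone (Fin.zero_le i))
      rw [cone_basis_of_not_lt 𝕜 c h, map_zero, pushChain_basis_succ, h0, cone_cone]

theorem boundary_pushChain (k : ℕ) (z : ChainSpace 𝕜 P (k + 1)) :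
    boundary 𝕜 Q k (pushChain 𝕜 a (k + 1) z) = pushChain 𝕜 a k (boundary 𝕜 P k z) := by
  induction k with
  | zero =>
    refine LinearMap.congr_fun (f := boundary 𝕜 Q 0 ∘ₗ pushChain 𝕜 a 1)
      (g := pushChain 𝕜 a 0 ∘ₗ boundary 𝕜 P 0) ((chainBasis 𝕜 P 1).ext fun c => ?_) z
    simp only [LinearMap.comp_apply]
    rw [pushChain_basis_succ, boundary_cone_zero, boundary_basis]
    simp
  | succ k ih =>
    refine LinearMap.congr_fun (f := boundary 𝕜 Q (k + 1) ∘ₗ pushChain 𝕜 a (k + 2))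
      (g := pushChain 𝕜 a (k + 1) ∘ₗ boundary 𝕜 P (k + 1))
      ((chainBasis 𝕜 P (k + 2)).ext fun c => ?_) z
    simp only [LinearMap.comp_apply]
    have h : chainBasis 𝕜 P (k + 1) (face 0 c) ∈ above 𝕜 (c 0) (k + 1) :=
      basis_mem_above fun i => (lt_face_zero c i).le
    rw [pushChain_basis_succ, boundary_cone (pushChain_mem_above a h), ih,
      boundary_basis_eq, map_sub, pushChain_cone a (boundary_mem_above h)]

theorem pushChain_basis {k : ℕ} (c : Fin k ↪o P) :
    pushChain 𝕜 a k (chainBasis 𝕜 P k c) = 0 ∨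
      ∃ f : Fin k ↪o Q, (∀ i, f i = a (c i)) ∧
        pushChain 𝕜 a k (chainBasis 𝕜 P k c) = chainBasis 𝕜 Q k f := by
  induction k with
  | zero =>
    refine Or.inr ⟨OrderEmbedding.ofIsEmpty, fun i => i.elim0, ?_⟩
    rw [pushChain, Module.Basis.constr_basis]
  | succ k ih =>
    rw [pushChain_basis_succ]
    obtain h | ⟨f, hf, h⟩ := ih (face 0 c)
    · exact Or.inl (by rw [h, map_zero])
    · rw [h]
      by_cases hlt : ∀ i, a (c 0) < f i
      · refine Or.inr ⟨consChain _ f hlt, Fin.cases rfl fun i => ?_, cone_basis_of_lt 𝕜 f hlt⟩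
        rw [consChain_succ, hf, face_apply, Fin.zero_succAbove]
      · exact Or.inl (cone_basis_of_not_lt 𝕜 f hlt)

variable {a b}

theorem liftChain_pushChain_zero (z : ChainSpace 𝕜 P 0) :
    liftChain 𝕜 b 0 (pushChain 𝕜 a 0 z) = z := by
  refine LinearMap.congr_fun (f := liftChain 𝕜 b 0 ∘ₗ pushChain 𝕜 a 0)
    (g := LinearMap.id) ((chainBasis 𝕜 P 0).ext fun f => ?_) z
  simp only [LinearMap.comp_apply, LinearMap.id_apply]
  rw [pushChain, Module.Basis.constr_basis, liftChain, Module.Basis.constr_basis]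
  congr 1
  exact RelEmbedding.ext fun i => i.elim0

theorem liftChain_boundary_mem_above
    (hb : ∀ k (f : Fin (k + 2) ↪o Q) i, b (k + 1) f ≤ b k (face i f))
    {k : ℕ} (f : Fin (k + 1) ↪o Q) :
    liftChain 𝕜 b k (boundary 𝕜 Q k (chainBasis 𝕜 Q (k + 1) f)) ∈ above 𝕜 (b k f) k := by
  induction k with
  | zero => exact mem_above_zero _ _
  | succ k ih =>
    rw [boundary_basis, map_sum]
    refine Submodule.sum_mem _ fun i _ => ?_
    rw [map_smul, liftChain_basis_succ]
    exact Submodule.smul_mem _ _ (above_anti (hb k f i) _ (cone_mem_above (ih _)))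

theorem liftChain_mem_above
    (hb : ∀ k (f : Fin (k + 2) ↪o Q) i, b (k + 1) f ≤ b k (face i f))
    {k : ℕ} (f : Fin (k + 1) ↪o Q) :
    liftChain 𝕜 b (k + 1) (chainBasis 𝕜 Q (k + 1) f) ∈ above 𝕜 (b k f) (k + 1) := by
  rw [liftChain_basis_succ]
  exact cone_mem_above (liftChain_boundary_mem_above hb f)

theorem boundary_liftChain
    (hb : ∀ k (f : Fin (k + 2) ↪o Q) i, b (k + 1) f ≤ b k (face i f))
    (k : ℕ) (z : ChainSpace 𝕜 Q (k + 1)) :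
    boundary 𝕜 P k (liftChain 𝕜 b (k + 1) z) = liftChain 𝕜 b k (boundary 𝕜 Q k z) := by
  induction k with
  | zero =>
    refine LinearMap.congr_fun (f := boundary 𝕜 P 0 ∘ₗ liftChain 𝕜 b 1)
      (g := liftChain 𝕜 b 0 ∘ₗ boundary 𝕜 Q 0) ((chainBasis 𝕜 Q 1).ext fun f => ?_) z
    simp only [LinearMap.comp_apply]
    rw [liftChain_basis_succ, boundary_cone_zero]
  | succ k ih =>
    refine LinearMap.congr_fun (f := boundary 𝕜 P (k + 1) ∘ₗ liftChain 𝕜 b (k + 2))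
      (g := liftChain 𝕜 b (k + 1) ∘ₗ boundary 𝕜 Q (k + 1))
      ((chainBasis 𝕜 Q (k + 2)).ext fun f => ?_) z
    simp only [LinearMap.comp_apply]
    rw [liftChain_basis_succ, boundary_cone (liftChain_boundary_mem_above hb f), ih,
      ← LinearMap.comp_apply (boundary 𝕜 Q k), boundary_boundary, LinearMap.zero_apply, map_zero,
      map_zero, sub_zero]

theorem pushChain_liftChain
    (hb : ∀ k (f : Fin (k + 2) ↪o Q) i, b (k + 1) f ≤ b k (face i f))
    (hab : ∀ k (f : Fin (k + 1) ↪o Q), a (b k f) = f 0)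
    (k : ℕ) (z : ChainSpace 𝕜 Q k) : pushChain 𝕜 a k (liftChain 𝕜 b k z) = z := by
  refine LinearMap.congr_fun (f := pushChain 𝕜 a k ∘ₗ liftChain 𝕜 b k)
    (g := LinearMap.id) ((chainBasis 𝕜 Q k).ext fun f => ?_) z
  simp only [LinearMap.comp_apply, LinearMap.id_apply]
  induction k with
  | zero =>
    rw [liftChain, Module.Basis.constr_basis, pushChain, Module.Basis.constr_basis]
    congr 1
    exact RelEmbedding.ext fun i => i.elim0
  | succ k ih =>
    have ih' : ∀ z, pushChain 𝕜 a k (liftChain 𝕜 b k z) = z := fun z =>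
      LinearMap.congr_fun (f := pushChain 𝕜 a k ∘ₗ liftChain 𝕜 b k)
        (g := LinearMap.id) ((chainBasis 𝕜 Q k).ext fun f => ih 0 f) z
    rw [liftChain_basis_succ, pushChain_cone a (liftChain_boundary_mem_above hb f), ih', hab,
      cone_boundary_basis]

variable (hb : ∀ k (f : Fin (k + 2) ↪o Q) i, b (k + 1) f ≤ b k (face i f))
  (hab : ∀ k (f : Fin (k + 1) ↪o Q), a (b k f) = f 0)
  (hba : ∀ k (c : Fin (k + 1) ↪o P) (f : Fin (k + 1) ↪o Q), (∀ i, f i = a (c i)) → c 0 ≤ b k f)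

include hb hba

theorem liftChain_pushChain_mem_above {k : ℕ} (c : Fin (k + 1) ↪o P) :
    liftChain 𝕜 b (k + 1) (pushChain 𝕜 a (k + 1) (chainBasis 𝕜 P (k + 1) c)) ∈
      above 𝕜 (c 0) (k + 1) := by
  obtain h | ⟨f, hf, h⟩ := pushChain_basis (𝕜 := 𝕜) a c
  · rw [h, LinearMap.map_zero]
    exact zero_mem _
  · rw [h]
    exact above_anti (hba k c f hf) _ (liftChain_mem_above hb f)

theorem chainHomotopy_mem_above {x : P} {k : ℕ} {z : ChainSpace 𝕜 P k} (hz : z ∈ above 𝕜 x k) :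
    chainHomotopy 𝕜 a b k z ∈ above 𝕜 x (k + 1) := by
  induction k generalizing x with
  | zero => exact zero_mem _
  | succ k ih =>
    refine map_mem_of_mem_above _ _ (fun c hc => ?_) hz
    have h : chainBasis 𝕜 P (k + 1) c ∈ above 𝕜 (c 0) (k + 1) :=
      basis_mem_above fun i => c.monotone (Fin.zero_le i)
    rw [chainHomotopy_basis_succ]
    exact above_anti (hc 0) _ (cone_mem_above (sub_mem (sub_mem h
      (liftChain_pushChain_mem_above hb hba c)) (ih (boundary_mem_above h))))

theorem boundary_chainHomotopy (k : ℕ) (z : ChainSpace 𝕜 P (k + 1)) :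
    boundary 𝕜 P (k + 1) (chainHomotopy 𝕜 a b (k + 1) z)
        + chainHomotopy 𝕜 a b k (boundary 𝕜 P k z) =
      z - liftChain 𝕜 b (k + 1) (pushChain 𝕜 a (k + 1) z) := by
  have key : ∀ k, (∀ c : Fin (k + 1) ↪o P, boundary 𝕜 P k (chainBasis 𝕜 P (k + 1) c
      - liftChain 𝕜 b (k + 1) (pushChain 𝕜 a (k + 1) (chainBasis 𝕜 P (k + 1) c))
      - chainHomotopy 𝕜 a b k (boundary 𝕜 P k (chainBasis 𝕜 P (k + 1) c))) = 0) →
      ∀ z : ChainSpace 𝕜 P (k + 1), boundary 𝕜 P (k + 1) (chainHomotopy 𝕜 a b (k + 1) z)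
        + chainHomotopy 𝕜 a b k (boundary 𝕜 P k z) =
      z - liftChain 𝕜 b (k + 1) (pushChain 𝕜 a (k + 1) z) := by
    intro k hw z
    refine LinearMap.congr_fun (f := boundary 𝕜 P (k + 1) ∘ₗ chainHomotopy 𝕜 a b (k + 1)
        + chainHomotopy 𝕜 a b k ∘ₗ boundary 𝕜 P k)
      (g := LinearMap.id - liftChain 𝕜 b (k + 1) ∘ₗ pushChain 𝕜 a (k + 1))
      ((chainBasis 𝕜 P (k + 1)).ext fun c => ?_) z
    simp only [LinearMap.comp_apply, LinearMap.id_apply, LinearMap.add_apply, LinearMap.sub_apply]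
    have h : chainBasis 𝕜 P (k + 1) c ∈ above 𝕜 (c 0) (k + 1) :=
      basis_mem_above fun i => c.monotone (Fin.zero_le i)
    rw [chainHomotopy_basis_succ, boundary_cone (sub_mem (sub_mem h
      (liftChain_pushChain_mem_above hb hba c))
      (chainHomotopy_mem_above hb hba (boundary_mem_above h))), hw c]
    simp
  induction k with
  | zero =>
    refine key 0 (fun c => ?_) z
    rw [map_sub, map_sub, boundary_liftChain hb, boundary_pushChain, liftChain_pushChain_zero,
      chainHomotopy]
    simp
  | succ k ih =>
    refine key (k + 1) (fun c => ?_) z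
    have h := ih (boundary 𝕜 P (k + 1) (chainBasis 𝕜 P (k + 2) c))
    rw [← LinearMap.comp_apply (boundary 𝕜 P k), boundary_boundary, LinearMap.zero_apply,
      map_zero, add_zero] at h
    rw [map_sub, map_sub, boundary_liftChain hb, boundary_pushChain, h, sub_self]

omit hba in
theorem liftChain_mem_cycles {k : ℕ} {z : ChainSpace 𝕜 Q k} (hz : z ∈ cycles 𝕜 Q k) :
    liftChain 𝕜 b k z ∈ cycles 𝕜 P k := by
  cases k with
  | zero => trivial
  | succ k =>
    rw [cycles, LinearMap.mem_ker] at hz ⊢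
    rw [boundary_liftChain hb, hz, map_zero]

omit hb hba in
theorem pushChain_mem_cycles {k : ℕ} {z : ChainSpace 𝕜 P k} (hz : z ∈ cycles 𝕜 P k) :
    pushChain 𝕜 a k z ∈ cycles 𝕜 Q k := by
  cases k with
  | zero => trivial
  | succ k =>
    rw [cycles, LinearMap.mem_ker] at hz ⊢
    rw [boundary_pushChain, hz, map_zero]

/-- A cycle differs from its image under `liftChain ∘ pushChain` by a boundary. -/
theorem exists_boundary_eq_sub {k : ℕ} {z : ChainSpace 𝕜 P k} (hz : z ∈ cycles 𝕜 P k) :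
    ∃ y, boundary 𝕜 P k y = z - liftChain 𝕜 b k (pushChain 𝕜 a k z) := by
  cases k with
  | zero =>
    refine ⟨0, ?_⟩
    rw [map_zero, liftChain_pushChain_zero, sub_self]
  | succ k =>
    rw [cycles, LinearMap.mem_ker] at hz
    refine ⟨chainHomotopy 𝕜 a b (k + 1) z, ?_⟩
    rw [← boundary_chainHomotopy hb hba, hz, map_zero, add_zero]

include hab

/-- A monotone map `a : P → Q` induces an isomorphism in homology if there is a map `b` from the
nonempty chains of `Q` to `P` which reverses inclusion, such that `a (b f)` is the minimum of `f`,
and such that the minimum of `c` lies below `b (a ∘ c)` whenever `a ∘ c` is a chain. -/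
theorem finrank_reducedHomology_eq (k : ℕ) :
    Module.finrank 𝕜 (ReducedHomology 𝕜 P k) = Module.finrank 𝕜 (ReducedHomology 𝕜 Q k) := by
  let F : cycles 𝕜 P k →ₗ[𝕜] ReducedHomology 𝕜 Q k :=
    (boundariesInCycles 𝕜 Q k).mkQ ∘ₗ
      (pushChain 𝕜 a k).restrict fun _ hz => pushChain_mem_cycles hz
  have hF : Function.Surjective F := by
    intro y
    obtain ⟨⟨z, hz⟩, rfl⟩ := Submodule.mkQ_surjective _ y
    refine ⟨⟨liftChain 𝕜 b k z, liftChain_mem_cycles hb hz⟩, ?_⟩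
    simp only [F, LinearMap.comp_apply]
    congr 1
    exact Subtype.ext (pushChain_liftChain hb hab k z)
  have hker : LinearMap.ker F = boundariesInCycles 𝕜 P k := by
    ext ⟨z, hz⟩
    rw [LinearMap.mem_ker, LinearMap.comp_apply, Submodule.mkQ_apply,
      Submodule.Quotient.mk_eq_zero, boundariesInCycles, boundariesInCycles,
      Submodule.submoduleOf, Submodule.submoduleOf, Submodule.mem_comap, Submodule.mem_comap]
    constructor
    · rintro ⟨y, hy⟩
      replace hy : boundary 𝕜 Q k y = pushChain 𝕜 a k z := hy
      obtain ⟨w, hw⟩ := exists_boundary_eq_sub hb hba hz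
      refine ⟨w + liftChain 𝕜 b (k + 1) y, ?_⟩
      rw [map_add, hw, boundary_liftChain hb, hy]
      simp
    · rintro ⟨y, hy⟩
      refine ⟨pushChain 𝕜 a (k + 1) y, ?_⟩
      rw [boundary_pushChain, hy]
      rfl
  exact ((Submodule.quotEquivOfEq _ _ hker).symm.trans
    (F.quotKerEquivOfSurjective hF)).finrank_eq

end Comparison

/-! ### From parabolic cosets to pairs of subsets -/

/-- Pairs `(A, B)` of subsets of `Fin n` of the same size, where `A` is proper and contains `0`,
ordered by inclusion in both components. -/
abbrev MatchedPair (n : ℕ) [NeZero n] : Type :=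
  {q : Finset (Fin n) × Finset (Fin n) // 0 ∈ q.1 ∧ q.1 ≠ Finset.univ ∧ q.1.card = q.2.card}

section Cosets

variable {n : ℕ}

theorem mem_fixedSpace {σ : Equiv.Perm (Fin n)} {v : sumZero n} :
    v ∈ fixedSpace σ ↔ ∀ x, v.1 (σ.symm x) = v.1 x := by
  rw [fixedSpace, LinearMap.mem_ker, LinearMap.sub_apply, sub_eq_zero, Subtype.ext_iff,
    funext_iff]
  rfl

theorem mem_sumZero {v : Fin n → ℝ} : v ∈ sumZero n ↔ ∑ i, v i = 0 := by
  simp [sumZero]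

theorem parabolicCosets_nonempty {C : Set (Equiv.Perm (Fin n))} (hC : C ∈ parabolicCosets n) :
    C.Nonempty := by
  obtain ⟨w, X, -, rfl⟩ := hC
  exact ⟨w, 1, (fixer X).one_mem, mul_one w⟩

theorem mul_inv_mul_mem {C : Set (Equiv.Perm (Fin n))} (hC : C ∈ parabolicCosets n)
    {u v w : Equiv.Perm (Fin n)} (hu : u ∈ C) (hv : v ∈ C) (hw : w ∈ C) : u * v⁻¹ * w ∈ C := by
  obtain ⟨g, X, -, rfl⟩ := hC
  rw [Set.mem_smul_set_iff_inv_smul_mem] at *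
  have := (fixer X).mul_mem ((fixer X).mul_mem hu ((fixer X).inv_mem hv)) hw
  simpa [mul_assoc] using this

/-- A parabolic subgroup acting transitively is the whole group. -/
theorem eq_univ_of_transitive [NeZero n] {C : Set (Equiv.Perm (Fin n))}
    (hC : C ∈ parabolicCosets n) (h : ∀ i, ∃ u ∈ C, ∃ v ∈ C, u i = v 0) : C = Set.univ := by
  obtain ⟨w, X, -, rfl⟩ := hC
  have hX : ∀ v ∈ X, v = 0 := by
    intro v hv
    have hconst : ∀ i, v.1 i = v.1 0 := by
      intro i
      obtain ⟨_, ⟨u, hu, rfl⟩, _, ⟨u', hu', rfl⟩, h⟩ := h i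
      have h' : u i = u' 0 := w.injective h
      have h1 := mem_fixedSpace.1 (hu hv) (u i)
      have h2 := mem_fixedSpace.1 (hu' hv) (u' 0)
      rw [Equiv.symm_apply_apply] at h1 h2
      rw [h1, h2, h']
    have hsum := mem_sumZero.1 v.2
    rw [Finset.sum_congr rfl fun i _ => hconst i] at hsum
    have h0 : v.1 0 = 0 := by simpa [NeZero.ne n] using hsum
    exact Subtype.ext (funext fun i => by rw [hconst, h0]; rfl)
  have hfix : (fixer X : Set (Equiv.Perm (Fin n))) = Set.univ :=
    Set.eq_univ_of_forall fun u v hv => by rw [hX v hv]; exact zero_mem _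
  rw [hfix, Set.smul_set_univ]

/-! #### The orbit of zero -/

open Classical in
/-- For a coset `C = w H`, the set `H 0`. -/
noncomputable def sourceBlock [NeZero n] (C : Set (Equiv.Perm (Fin n))) : Finset (Fin n) :=
  Finset.univ.filter fun i => ∃ u ∈ C, ∃ v ∈ C, u i = v 0

open Classical in
/-- For a coset `C = w H`, the set `w H 0`. -/
noncomputable def targetBlock [NeZero n] (C : Set (Equiv.Perm (Fin n))) : Finset (Fin n) :=
  Finset.univ.filter fun j => ∃ v ∈ C, v 0 = j

section Orbit

variable [NeZero n] {C : Set (Equiv.Perm (Fin n))}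

theorem mem_sourceBlock {i : Fin n} : i ∈ sourceBlock C ↔ ∃ u ∈ C, ∃ v ∈ C, u i = v 0 := by
  simp [sourceBlock]

theorem mem_targetBlock {j : Fin n} : j ∈ targetBlock C ↔ ∃ v ∈ C, v 0 = j := by
  simp [targetBlock]

theorem apply_mem_targetBlock (hC : C ∈ parabolicCosets n) {w : Equiv.Perm (Fin n)} (hw : w ∈ C)
    (i : Fin n) : w i ∈ targetBlock C ↔ i ∈ sourceBlock C := by
  rw [mem_sourceBlock, mem_targetBlock]
  constructor
  · rintro ⟨v, hv, h⟩
    exact ⟨w, hw, v, hv, h.symm⟩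
  · rintro ⟨u, hu, v, hv, h⟩
    refine ⟨_, mul_inv_mul_mem hC hw hu hv, ?_⟩
    simp [← h]

/-- The pair of blocks containing, respectively, `0` and its images. -/
noncomputable def zeroBlocks (C : ProperParabolicCoset n) : MatchedPair n :=
  ⟨(sourceBlock C.1, targetBlock C.1), by
    obtain ⟨w, hw⟩ := parabolicCosets_nonempty C.2.1
    refine ⟨mem_sourceBlock.2 ⟨w, hw, w, hw, rfl⟩, fun h => C.2.2 ?_, ?_⟩
    · exact eq_univ_of_transitive C.2.1 fun i =>
        mem_sourceBlock.1 (Finset.eq_univ_iff_forall.1 h i)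
    · exact Finset.card_equiv w fun i => (apply_mem_targetBlock C.2.1 hw i).symm⟩

theorem zeroBlocks_mono : Monotone (zeroBlocks (n := n)) := by
  intro C D h
  refine ⟨fun i hi => ?_, fun j hj => ?_⟩
  · obtain ⟨u, hu, v, hv, h'⟩ := mem_sourceBlock.1 hi
    exact mem_sourceBlock.2 ⟨u, h hu, v, h hv, h'⟩
  · obtain ⟨v, hv, h'⟩ := mem_targetBlock.1 hj
    exact mem_targetBlock.2 ⟨v, h hv, h'⟩

end Orbit

/-! #### The coset of a chain of pairs -/

section ChainCoset

theorem mem_iff_card_notMem_le {k : ℕ} {A : Fin k → Finset (Fin n)} (hA : Monotone A)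
    (x : Fin n) (i : Fin k) :
    x ∈ A i ↔ (Finset.univ.filter fun j => x ∉ A j).card ≤ i := by
  constructor
  · intro hx
    rw [← Fin.card_Iio i]
    refine Finset.card_le_card fun j hj => Finset.mem_Iio.2 ?_
    by_contra hij
    exact (Finset.mem_filter.1 hj).2 (hA (not_lt.1 hij) hx)
  · intro h
    by_contra hx
    have : (Finset.Iic i).card ≤ (Finset.univ.filter fun j => x ∉ A j).card :=
      Finset.card_le_card fun j hj => Finset.mem_filter.2
        ⟨Finset.mem_univ _, fun hj' => hx (hA (Finset.mem_Iic.1 hj) hj')⟩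
    rw [Fin.card_Iic] at this
    omega

/-- A chain of pairs of sets of the same size is matched by a permutation. -/
theorem exists_perm_of_card_eq {k : ℕ} {A B : Fin k → Finset (Fin n)} (hA : Monotone A)
    (hB : Monotone B) (h : ∀ i, (A i).card = (B i).card) :
    ∃ w : Equiv.Perm (Fin n), ∀ i x, w x ∈ B i ↔ x ∈ A i := by
  classical
  -- the number of sets of the chain which avoid `x` determines the sets which contain `x`
  let a : Fin n → ℕ := fun x => (Finset.univ.filter fun j => x ∉ A j).card
  let b : Fin n → ℕ := fun x => (Finset.univ.filter fun j => x ∉ B j).card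
  have hle : ∀ m, (Finset.univ.filter fun x => a x ≤ m).card =
      (Finset.univ.filter fun x => b x ≤ m).card := by
    intro m
    by_cases hm : m < k
    · have h1 : (Finset.univ.filter fun x => a x ≤ m) = A ⟨m, hm⟩ := by
        ext x; simp [a, mem_iff_card_notMem_le hA x ⟨m, hm⟩]
      have h2 : (Finset.univ.filter fun x => b x ≤ m) = B ⟨m, hm⟩ := by
        ext x; simp [b, mem_iff_card_notMem_le hB x ⟨m, hm⟩]
      rw [h1, h2, h]
    · have hk : ∀ s : Finset (Fin k), s.card ≤ m := fun s =>
        (Finset.card_le_univ s).trans (by simpa using not_lt.1 hm)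
      rw [Finset.filter_true_of_mem fun x _ => hk _, Finset.filter_true_of_mem fun x _ => hk _]
  have heq : ∀ m, (Finset.univ.filter fun x => a x = m).card =
      (Finset.univ.filter fun x => b x = m).card := by
    intro m
    cases m with
    | zero => simpa using hle 0
    | succ m =>
      have hsplit : ∀ c : Fin n → ℕ, (Finset.univ.filter fun x => c x ≤ m + 1).card =
          (Finset.univ.filter fun x => c x ≤ m).card +
            (Finset.univ.filter fun x => c x = m + 1).card := by
        intro c
        rw [← Finset.card_union_of_disjoint]
        · congr 1
          ext x
          simp only [Finset.mem_filter, Finset.mem_union, Finset.mem_univ, true_and]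
          omega
        · refine Finset.disjoint_filter.2 fun x _ h1 h2 => by omega
      have h1 := hle (m + 1)
      rw [hsplit, hsplit, hle m] at h1
      exact Nat.add_left_cancel h1
  have hequiv : ∀ m, Nonempty ({x // a x = m} ≃ {x // b x = m}) := fun m =>
    Fintype.card_eq.1 (by rw [Fintype.card_subtype, Fintype.card_subtype, heq])
  refine ⟨Equiv.ofFiberEquiv fun m => (hequiv m).some, fun i x => ?_⟩
  have hw : b (Equiv.ofFiberEquiv (fun m => (hequiv m).some) x) = a x :=
    Equiv.ofFiberEquiv_map _ x
  rw [mem_iff_card_notMem_le hA, mem_iff_card_notMem_le hB]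
  exact iff_of_eq (congrArg (· ≤ (i : ℕ)) hw)

/-- The permutations preserving each member of a family of sets form a parabolic subgroup. -/
theorem exists_fixer_eq {ι : Type*} (A : ι → Finset (Fin n)) :
    ∃ X ∈ intersectionLattice n, (fixer X : Set (Equiv.Perm (Fin n))) =
      {u | ∀ i x, u x ∈ A i ↔ x ∈ A i} := by
  classical
  refine ⟨_, ⟨{t | ∃ x y, x ≠ y ∧ (∀ i, x ∈ A i ↔ y ∈ A i) ∧ t = Equiv.swap x y},
    fun t ⟨x, y, hxy, _, ht⟩ => ⟨x, y, hxy, ht⟩, rfl⟩, ?_⟩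
  ext u
  constructor
  · intro hu i x
    -- the indicator function of `A i`, shifted and scaled so that its sum vanishes
    let v : Fin n → ℝ := fun y => n * (if y ∈ A i then 1 else 0) - (A i).card
    have hv : v ∈ sumZero n := by
      rw [mem_sumZero]
      simp [v, Finset.sum_sub_distrib, mul_comm]
    have hX : (⟨v, hv⟩ : sumZero n) ∈ ⨅ t ∈ {t | ∃ x y, x ≠ y ∧ (∀ i, x ∈ A i ↔ y ∈ A i) ∧
        t = Equiv.swap x y}, fixedSpace t := by
      simp only [Submodule.mem_iInf]
      rintro _ ⟨x, y, -, hxy, rfl⟩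
      refine mem_fixedSpace.2 fun z => ?_
      have : (Equiv.swap x y) z ∈ A i ↔ z ∈ A i := by
        rw [Equiv.swap_apply_def]
        split_ifs with h1 h2
        · rw [h1, hxy]
        · rw [h2, hxy]
        · rfl
      simp only [v, Equiv.symm_swap, this]
    have h := mem_fixedSpace.1 (hu hX) (u x)
    have hn : (n : ℝ) ≠ 0 := Nat.cast_ne_zero.2 fun h => by subst h; exact x.elim0
    simp only [v, Equiv.symm_apply_apply, sub_left_inj] at h
    have h := mul_left_cancel₀ hn h
    by_cases h1 : x ∈ A i <;> by_cases h2 : u x ∈ A i <;> simp_all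
  · intro hu v hv
    refine mem_fixedSpace.2 fun x => ?_
    by_cases hx : u.symm x = x
    · rw [hx]
    · simp only [Submodule.mem_iInf] at hv
      have h := mem_fixedSpace.1 (hv _ ⟨u.symm x, x, hx, fun i => ?_, rfl⟩) x
      · rw [Equiv.symm_swap, Equiv.swap_apply_right] at h
        exact h
      · rw [← hu i, Equiv.apply_symm_apply]

variable [NeZero n]

/-- The permutations which match the pairs of a chain. -/
def matchingPerms {k : ℕ} (f : Fin k ↪o MatchedPair n) : Set (Equiv.Perm (Fin n)) :=
  {w | ∀ i x, w x ∈ (f i).1.2 ↔ x ∈ (f i).1.1}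

theorem matchingPerms_nonempty {k : ℕ} (f : Fin k ↪o MatchedPair n) :
    (matchingPerms f).Nonempty :=
  exists_perm_of_card_eq (fun _ _ h => (f.monotone h).1) (fun _ _ h => (f.monotone h).2)
    fun i => (f i).2.2.2

theorem matchingPerms_mem {k : ℕ} (f : Fin (k + 1) ↪o MatchedPair n) :
    matchingPerms f ∈ parabolicCosets n ∧ matchingPerms f ≠ Set.univ := by
  obtain ⟨w, hw⟩ := matchingPerms_nonempty f
  obtain ⟨X, hX, h⟩ := exists_fixer_eq fun i => (f i).1.1
  refine ⟨⟨w, X, hX, ?_⟩, fun huniv => ?_⟩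
  · ext u
    rw [h, Set.mem_smul_set_iff_inv_smul_mem]
    refine forall₂_congr fun i x => iff_congr ?_ Iff.rfl
    rw [← hw i, smul_eq_mul, Equiv.Perm.mul_apply, Equiv.Perm.coe_inv, Equiv.apply_symm_apply]
  · obtain ⟨z, hz⟩ := not_forall.1 fun h => (f 0).2.2.1 (Finset.eq_univ_iff_forall.2 h)
    have h1 : w * Equiv.swap 0 z ∈ matchingPerms f := huniv ▸ Set.mem_univ _
    have h2 := (h1 0 0).2 (f 0).2.1
    rw [Equiv.Perm.mul_apply, Equiv.swap_apply_left, hw] at h2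
    exact hz h2

theorem mul_swap_mem_matchingPerms {k : ℕ} {f : Fin (k + 1) ↪o MatchedPair n}
    {w : Equiv.Perm (Fin n)} (hw : w ∈ matchingPerms f) {x : Fin n} (hx : x ∈ (f 0).1.1) :
    w * Equiv.swap 0 x ∈ matchingPerms f := by
  intro i y
  rw [Equiv.Perm.mul_apply, hw, Equiv.swap_apply_def]
  split_ifs with h1 h2
  · exact iff_of_true ((f.monotone (Fin.zero_le i)).1 hx) (h1 ▸ (f i).2.1)
  · exact iff_of_true (f i).2.1 (h2 ▸ (f.monotone (Fin.zero_le i)).1 hx)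
  · rfl

/-- The parabolic coset of a nonempty chain of pairs. -/
def chainCoset (k : ℕ) (f : Fin (k + 1) ↪o MatchedPair n) : ProperParabolicCoset n :=
  ⟨matchingPerms f, matchingPerms_mem f⟩

theorem zeroBlocks_chainCoset (k : ℕ) (f : Fin (k + 1) ↪o MatchedPair n) :
    zeroBlocks (chainCoset k f) = f 0 := by
  obtain ⟨w, hw⟩ := matchingPerms_nonempty f
  refine Subtype.ext (Prod.ext ?_ ?_)
  · ext x
    refine mem_sourceBlock.trans ⟨?_, fun hx => ?_⟩
    · rintro ⟨u, hu, v, hv, h⟩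
      rw [← hu 0, h, hv 0]
      exact (f 0).2.1
    · exact ⟨_, mul_swap_mem_matchingPerms hw hx, w, hw, by simp⟩
  · ext y
    refine mem_targetBlock.trans ⟨?_, fun hy => ?_⟩
    · rintro ⟨v, hv, rfl⟩
      exact (hv 0 0).2 (f 0).2.1
    · have hx : w.symm y ∈ (f 0).1.1 := by rwa [← hw 0, Equiv.apply_symm_apply]
      exact ⟨_, mul_swap_mem_matchingPerms hw hx, by simp⟩

/-- The parabolic coset poset has the homology of the poset of matched pairs. -/
theorem finrank_reducedHomology_parabolicCosets (𝕜 : Type*) [Field 𝕜] (k : ℕ) :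
    Module.finrank 𝕜 (ReducedHomology 𝕜 (ProperParabolicCoset n) k) =
      Module.finrank 𝕜 (ReducedHomology 𝕜 (MatchedPair n) k) := by
  refine finrank_reducedHomology_eq (a := ⟨zeroBlocks, zeroBlocks_mono⟩) (b := chainCoset)
    (fun k f i w hw j => hw _) zeroBlocks_chainCoset (fun k c f hf w hw i x => ?_) k
  have hwi : w ∈ (c i).1 := c.monotone (Fin.zero_le i) hw
  rw [hf i]
  exact apply_mem_targetBlock (c i).2.1 hwi x

end ChainCoset

end Cosets

/-! ### Chains as finite sets -/

section ChainSets

variable {α : Type*} [PartialOrder α]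

/-- The set of elements of a chain. -/
def chainSet {k : ℕ} (c : Fin k ↪o α) : Finset α :=
  Finset.univ.map c.toEmbedding

@[simp] theorem mem_chainSet {k : ℕ} {c : Fin k ↪o α} {x : α} :
    x ∈ chainSet c ↔ ∃ i, c i = x := by
  simp [chainSet]

theorem card_chainSet {k : ℕ} (c : Fin k ↪o α) : (chainSet c).card = k := by
  simp [chainSet]

theorem isChain_chainSet {k : ℕ} (c : Fin k ↪o α) : IsChain (· ≤ ·) (chainSet c : Set α) := by
  intro x hx y hy _
  obtain ⟨i, rfl⟩ := mem_chainSet.1 (Finset.mem_coe.1 hx)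
  obtain ⟨j, rfl⟩ := mem_chainSet.1 (Finset.mem_coe.1 hy)
  exact (le_total i j).imp (fun h => c.monotone h) (fun h => c.monotone h)

theorem chainSet_injective {k : ℕ} : Function.Injective (chainSet (α := α) (k := k)) := by
  intro c d h
  refine OrderEmbedding.range_inj.1 (Set.ext fun x => ?_)
  simpa using Finset.ext_iff.1 h x

theorem exists_chainSet_eq {k : ℕ} {s : Finset α} (hs : IsChain (· ≤ ·) (s : Set α))
    (hk : s.card = k) : ∃ c : Fin k ↪o α, chainSet c = s := by
  classical
  induction k generalizing s with
  | zero =>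
    exact ⟨OrderEmbedding.ofIsEmpty, by simp [Finset.card_eq_zero.1 hk, chainSet]⟩
  | succ k ih =>
    obtain ⟨x, hx⟩ := s.exists_minimal (Finset.card_pos.1 (by omega))
    obtain ⟨c, hc⟩ := ih (s := s.erase x) (hs.mono (by simp))
      (by rw [Finset.card_erase_of_mem hx.1]; omega)
    have hlt : ∀ i, x < c i := by
      intro i
      have hi : c i ∈ s.erase x := hc ▸ mem_chainSet.2 ⟨i, rfl⟩
      obtain ⟨hne, hi⟩ := Finset.mem_erase.1 hi
      refine lt_of_le_of_ne ?_ hne.symm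
      exact (hs hx.1 hi hne.symm).elim id fun h => hx.2 hi h
    refine ⟨consChain x c hlt, ?_⟩
    rw [← Finset.insert_erase hx.1, ← hc]
    ext y
    rw [mem_chainSet, Finset.mem_insert, mem_chainSet, Fin.exists_fin_succ]
    simp [eq_comm]

theorem chainSet_face {k : ℕ} [DecidableEq α] (c : Fin (k + 1) ↪o α) (i : Fin (k + 1)) :
    chainSet (face i c) = (chainSet c).erase (c i) := by
  ext x
  rw [Finset.mem_erase, mem_chainSet, mem_chainSet]
  constructor
  · rintro ⟨j, rfl⟩
    exact ⟨fun h => Fin.succAbove_ne i j (c.injective h), _, rfl⟩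
  · rintro ⟨hne, j, rfl⟩
    obtain ⟨l, hl⟩ := Fin.exists_succAbove_eq (x := j) (y := i) fun h => hne (by rw [h])
    exact ⟨l, by rw [face_apply, hl]⟩

variable (α) in
open Classical in
/-- The chains with `k` elements, as finite sets. -/
noncomputable def chainSets [Fintype α] (k : ℕ) : Finset (Finset α) :=
  Finset.univ.filter fun s => IsChain (· ≤ ·) (s : Set α) ∧ s.card = k

theorem mem_chainSets [Fintype α] {k : ℕ} {s : Finset α} :
    s ∈ chainSets α k ↔ IsChain (· ≤ ·) (s : Set α) ∧ s.card = k := by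
  simp [chainSets]

/-- Chains correspond to their sets of elements. -/
noncomputable def chainEquiv [Fintype α] (k : ℕ) : (Fin k ↪o α) ≃ chainSets α k :=
  Equiv.ofBijective
    (fun c => ⟨chainSet c, mem_chainSets.2 ⟨isChain_chainSet c, card_chainSet c⟩⟩)
    ⟨fun _ _ h => chainSet_injective (congrArg Subtype.val h), fun s =>
      let ⟨c, hc⟩ := exists_chainSet_eq (mem_chainSets.1 s.2).1 (mem_chainSets.1 s.2).2
      ⟨c, Subtype.ext hc⟩⟩

variable (𝕜 : Type*) [Field 𝕜]

theorem finrank_chainSpace [Fintype α] (k : ℕ) :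
    Module.finrank 𝕜 (ChainSpace 𝕜 α k) = (chainSets α k).card := by
  rw [Module.finrank_eq_nat_card_basis (chainBasis 𝕜 α k), Nat.card_congr (chainEquiv k)]
  simp

theorem coeff_boundary_face {k : ℕ} (c : Fin (k + 1) ↪o α) (i : Fin (k + 1)) :
    (chainBasis 𝕜 α k).coord (face i c) (boundary 𝕜 α k (chainBasis 𝕜 α (k + 1) c)) ≠ 0 := by
  classical
  rw [boundary_basis, map_sum, Finset.sum_eq_single i]
  · simp
  · intro j _ hj
    rw [map_smul, Module.Basis.coord_apply, Module.Basis.repr_self, Finsupp.single_eq_of_ne,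
      smul_zero]
    intro h
    have h1 := congrArg chainSet h
    rw [chainSet_face, chainSet_face] at h1
    have h2 : c j ∈ (chainSet c).erase (c i) :=
      Finset.mem_erase.2 ⟨fun h => hj (c.injective h), mem_chainSet.2 ⟨j, rfl⟩⟩
    rw [h1] at h2
    exact (Finset.mem_erase.1 h2).1 rfl
  · simp

theorem exists_face_eq_of_coeff_boundary_ne_zero {k : ℕ} {c : Fin (k + 1) ↪o α} {d : Fin k ↪o α}
    (h : (chainBasis 𝕜 α k).coord d (boundary 𝕜 α k (chainBasis 𝕜 α (k + 1) c)) ≠ 0) :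
    ∃ i, face i c = d := by
  classical
  by_contra hne
  push Not at hne
  refine h ?_
  rw [boundary_basis, map_sum]
  refine Finset.sum_eq_zero fun i _ => ?_
  rw [map_smul, Module.Basis.coord_apply, Module.Basis.repr_self,
    Finsupp.single_eq_of_ne (hne i).symm, smul_zero]

end ChainSets

/-! ### Ranks of the boundary maps -/

section Ranks

/-- A family of vectors is linearly independent if its pairings with a family of functionals form a
matrix with nonzero diagonal which is triangular with respect to the order given by `pot`. -/
theorem linearIndependent_of_triangular {𝕜 ι M : Type*} [Field 𝕜] [Fintype ι] [AddCommGroup M]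
    [Module 𝕜 M] (v : ι → M) (l : ι → M →ₗ[𝕜] 𝕜) (pot : ι → ℕ) (h₁ : ∀ i, l i (v i) ≠ 0)
    (h₂ : ∀ i j, j ≠ i → l i (v j) ≠ 0 → pot i < pot j) : LinearIndependent 𝕜 v := by
  classical
  rw [Fintype.linearIndependent_iff]
  intro g hg
  by_contra hne
  push Not at hne
  obtain ⟨i, hi, hmax⟩ := (Finset.univ.filter fun i => g i ≠ 0).exists_max_image pot
    (by simpa [Finset.Nonempty] using hne)
  replace hi : g i ≠ 0 := by simpa using hi
  have h := congrArg (l i) hg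
  rw [map_sum, map_zero, Finset.sum_eq_single i] at h
  · rw [map_smul, smul_eq_mul] at h
    exact (mul_ne_zero hi (h₁ i)) h
  · intro j _ hj
    rw [map_smul, smul_eq_mul]
    by_contra hprod
    have hj0 := left_ne_zero_of_mul hprod
    exact absurd (hmax j (by simpa using hj0))
      (not_le.2 (h₂ i j hj (right_ne_zero_of_mul hprod)))
  · simp

variable (𝕜 : Type*) [Field 𝕜] {α : Type*} [PartialOrder α] [Fintype α]

theorem finrank_range_boundary_add_le (k : ℕ) :
    Module.finrank 𝕜 (LinearMap.range (boundary 𝕜 α (k + 1)))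
      + Module.finrank 𝕜 (LinearMap.range (boundary 𝕜 α k)) ≤ (chainSets α (k + 1)).card := by
  rw [← finrank_chainSpace 𝕜, ← LinearMap.finrank_range_add_finrank_ker (boundary 𝕜 α k), add_comm]
  exact Nat.add_le_add_left
    (Submodule.finrank_mono (LinearMap.range_le_ker_iff.2 (boundary_boundary 𝕜 α k))) _

variable {a : ℕ → ℕ} {N : ℕ} (h₀ : a 0 = 0)
  (hrank : ∀ k, a (k + 1) ≤ Module.finrank 𝕜 (LinearMap.range (boundary 𝕜 α k)))
  (hcard : ∀ k < N, (chainSets α k).card = a k + a (k + 1))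

include h₀ hrank hcard in
/-- Lower bounds for the ranks of the boundary maps are attained if they add up to the dimensions
of the chain spaces. -/
theorem finrank_range_boundary_eq {k : ℕ} (hk : k < N) :
    Module.finrank 𝕜 (LinearMap.range (boundary 𝕜 α k)) = a (k + 1) := by
  refine le_antisymm ?_ (hrank k)
  cases k with
  | zero =>
    have h := hcard 0 hk
    rw [h₀, zero_add, ← finrank_chainSpace 𝕜] at h
    exact (Submodule.finrank_le _).trans h.le
  | succ k =>
    have h1 := finrank_range_boundary_add_le 𝕜 (α := α) k
    have h2 := hcard (k + 1) hk
    have h3 := hrank k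
    omega

include h₀ hrank hcard in
theorem finrank_reducedHomology_add_eq (hN : chainSets α (N + 1) = ∅) :
    Module.finrank 𝕜 (ReducedHomology 𝕜 α N) + a N = (chainSets α N).card := by
  have hbot : boundariesInCycles 𝕜 α N = ⊥ := by
    have h0 : Module.finrank 𝕜 (ChainSpace 𝕜 α (N + 1)) = 0 := by
      rw [finrank_chainSpace, hN, Finset.card_empty]
    have := Module.finrank_zero_iff.1 h0
    rw [eq_bot_iff]
    rintro x ⟨y, hy⟩
    rw [Subsingleton.elim y 0, map_zero] at hy
    exact Subtype.ext hy.symm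
  have hcycles : Module.finrank 𝕜 (ReducedHomology 𝕜 α N) = Module.finrank 𝕜 (cycles 𝕜 α N) :=
    (Submodule.quotEquivOfEqBot _ hbot).finrank_eq
  rw [hcycles, ← finrank_chainSpace 𝕜]
  cases N with
  | zero => rw [h₀, cycles, finrank_top, add_zero]
  | succ N =>
    rw [← LinearMap.finrank_range_add_finrank_ker (boundary 𝕜 α N),
      finrank_range_boundary_eq 𝕜 h₀ hrank hcard N.lt_succ_self, cycles, add_comm]

include h₀ hrank hcard in
/-- The top homology is the only nonzero one, so that its dimension is the Euler characteristic up
to sign. -/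
theorem finrank_reducedHomology_eq_sum (hN : chainSets α (N + 1) = ∅) :
    (Module.finrank 𝕜 (ReducedHomology 𝕜 α N) : ℤ) =
      (-1) ^ N * ∑ k ∈ Finset.range (N + 1), (-1) ^ k * ((chainSets α k).card : ℤ) := by
  have h := finrank_reducedHomology_add_eq 𝕜 h₀ hrank hcard hN
  have hsum : ∀ m ≤ N, ∑ k ∈ Finset.range m, (-1 : ℤ) ^ k * ((chainSets α k).card : ℤ) =
      -(-1) ^ m * a m := by
    intro m hm
    induction m with
    | zero => simp [h₀]
    | succ m ih =>
      rw [Finset.sum_range_succ, ih (by omega), hcard m (by omega)]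
      push_cast
      ring
  rw [Finset.sum_range_succ, hsum N le_rfl, ← h]
  have h2 : ((-1 : ℤ) ^ N) * (-1) ^ N = 1 := by rw [← mul_pow]; simp
  push_cast
  linear_combination (-(Module.finrank 𝕜 (ReducedHomology 𝕜 α N) : ℤ)) * h2

end Ranks

/-! ### Matchings from inversion sets -/

section Toggles

variable {α I : Type*}

/-- The inversions of a set of elements: those of any of its members. -/
def inversions [DecidableEq I] (inv : α → Finset I) (s : Finset α) : Finset I := s.biUnion inv

variable [DecidableEq I] {inv : α → Finset I}

theorem mem_inversions {s : Finset α} {i : I} :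
    i ∈ inversions inv s ↔ ∃ q ∈ s, i ∈ inv q := Finset.mem_biUnion

theorem inversions_mono {s t : Finset α} (h : s ⊆ t) : inversions inv s ⊆ inversions inv t :=
  Finset.biUnion_subset_biUnion_of_subset_left _ h

variable [PartialOrder α] [Fintype α] [DecidableEq α]

open Classical in
/-- The elements comparable to all members of `s` whose presence in `s` does not affect the set of
inversions. -/
noncomputable def toggles (inv : α → Finset I) (s : Finset α) : Finset α :=
  Finset.univ.filter fun q => (∀ p ∈ s, p ≤ q ∨ q ≤ p) ∧ inv q ⊆ inversions inv (s.erase q)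

theorem mem_toggles {s : Finset α} {q : α} :
    q ∈ toggles inv s ↔ (∀ p ∈ s, p ≤ q ∨ q ≤ p) ∧ inv q ⊆ inversions inv (s.erase q) := by
  simp [toggles]

/-- The conditions under which the elements of `toggles inv s` can be added to and removed from
the chain `s` independently of one another. -/
structure IsInversionSystem (inv : α → Finset I) : Prop where
  comparable : ∀ {s : Finset α}, IsChain (· ≤ ·) (s : Set α) → ∀ {q q' : α},
    q ∈ toggles inv s → q' ∈ toggles inv s → q ≤ q' ∨ q' ≤ q
  subset_inversions : ∀ {s : Finset α}, IsChain (· ≤ ·) (s : Set α) → ∀ {q q' : α},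
    q ∈ toggles inv s → q' ∈ toggles inv s → q ≠ q' →
      ∀ i ∈ inv q, ∃ p ∈ s, p ≠ q ∧ p ≠ q' ∧ i ∈ inv p

theorem inversions_insert_eq_erase {s : Finset α} {q : α} (hq : q ∈ toggles inv s) :
    inversions inv (insert q s) = inversions inv (s.erase q) := by
  refine subset_antisymm (fun i hi => ?_)
    (inversions_mono ((Finset.erase_subset _ _).trans (Finset.subset_insert _ _)))
  obtain ⟨p, hp, hi⟩ := mem_inversions.1 hi
  by_cases hpq : p = q
  · exact (mem_toggles.1 hq).2 (hpq ▸ hi)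
  · exact mem_inversions.2 ⟨p, Finset.mem_erase.2 ⟨hpq, Finset.mem_of_mem_insert_of_ne hp hpq⟩, hi⟩

theorem isChain_insert_of_mem_toggles {s : Finset α} (hs : IsChain (· ≤ ·) (s : Set α)) {q : α}
    (hq : q ∈ toggles inv s) : IsChain (· ≤ ·) ((insert q s : Finset α) : Set α) := by
  rw [Finset.coe_insert]
  exact hs.insert fun p hp _ => ((mem_toggles.1 hq).1 p hp).symm

/-- The toggles of a chain are unaffected by toggling one of them. -/
theorem IsInversionSystem.toggles_insert_eq_erase (h : IsInversionSystem inv) {s : Finset α}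
    (hs : IsChain (· ≤ ·) (s : Set α)) {q : α} (hq : q ∈ toggles inv s) :
    toggles inv (insert q s) = toggles inv (s.erase q) := by
  have hqi : q ∈ toggles inv (insert q s) := by
    refine mem_toggles.2 ⟨fun p hp => ?_, ?_⟩
    · obtain rfl | hp := Finset.mem_insert.1 hp
      · exact Or.inl le_rfl
      · exact (mem_toggles.1 hq).1 p hp
    · exact (mem_toggles.1 hq).2.trans
        (inversions_mono (Finset.erase_subset_erase _ (Finset.subset_insert _ _)))
  have hqe : q ∈ toggles inv (s.erase q) := by
    refine mem_toggles.2 ⟨fun p hp => (mem_toggles.1 hq).1 p (Finset.mem_of_mem_erase hp), ?_⟩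
    rw [Finset.erase_idem]
    exact (mem_toggles.1 hq).2
  ext p
  constructor
  · intro hp
    refine mem_toggles.2 ⟨fun r hr => (mem_toggles.1 hp).1 r
      (Finset.mem_insert_of_mem (Finset.mem_of_mem_erase hr)), fun i hi => ?_⟩
    by_cases hpq : p = q
    · subst hpq
      exact (mem_toggles.1 hqe).2 hi
    · obtain ⟨r, hr, hrp, hrq, hir⟩ := h.subset_inversions
        (isChain_insert_of_mem_toggles hs hq) hp hqi hpq i hi
      exact mem_inversions.2 ⟨r, by simp_all, hir⟩
  · intro hp
    refine mem_toggles.2 ⟨fun r hr => ?_, ?_⟩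
    · by_cases hrq : r = q
      · subst hrq
        exact h.comparable (hs.mono (by simp)) hqe hp
      · exact (mem_toggles.1 hp).1 r (by simp_all)
    · exact (mem_toggles.1 hp).2.trans (inversions_mono (Finset.erase_subset_erase _
        ((Finset.erase_subset _ _).trans (Finset.subset_insert _ _))))

theorem IsInversionSystem.toggles_erase (h : IsInversionSystem inv) {s : Finset α}
    (hs : IsChain (· ≤ ·) (s : Set α)) {q : α} (hq : q ∈ toggles inv s) :
    toggles inv (s.erase q) = toggles inv s := by
  by_cases hqs : q ∈ s
  · rw [← h.toggles_insert_eq_erase hs hq, Finset.insert_eq_of_mem hqs]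
  · rw [Finset.erase_eq_of_notMem hqs]

theorem IsInversionSystem.toggles_insert (h : IsInversionSystem inv) {s : Finset α}
    (hs : IsChain (· ≤ ·) (s : Set α)) {q : α} (hq : q ∈ toggles inv s) :
    toggles inv (insert q s) = toggles inv s := by
  rw [h.toggles_insert_eq_erase hs hq, h.toggles_erase hs hq]

open Classical in
/-- A choice of an element of `toggles inv s`, which depends on `s` only through
`toggles inv s`. -/
noncomputable def pivot (inv : α → Finset I) (s : Finset α) : Option α :=
  if h : (toggles inv s).Nonempty then some h.choose else none

theorem mem_toggles_of_pivot {s : Finset α} {q : α} (h : pivot inv s = some q) :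
    q ∈ toggles inv s := by
  rw [pivot] at h
  split_ifs at h with hne
  rw [← Option.some.inj h]
  exact hne.choose_spec

theorem pivot_congr {s t : Finset α} (h : toggles inv s = toggles inv t) :
    pivot inv s = pivot inv t := by
  simp only [pivot, h]

theorem exists_pivot {s : Finset α} (h : (toggles inv s).Nonempty) : ∃ q, pivot inv s = some q :=
  ⟨_, dif_pos h⟩

open Classical in
/-- The `k`-element chains which contain their pivot. -/
noncomputable def downChains (inv : α → Finset I) (k : ℕ) : Finset (Finset α) :=
  (chainSets α k).filter fun s => ∃ q ∈ s, pivot inv s = some q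

open Classical in
/-- The `k`-element chains with a pivot which they do not contain. -/
noncomputable def upChains (inv : α → Finset I) (k : ℕ) : Finset (Finset α) :=
  (chainSets α k).filter fun s => ∃ q ∉ s, pivot inv s = some q

open Classical in
/-- The `k`-element chains without pivot. -/
noncomputable def criticalChains (inv : α → Finset I) (k : ℕ) : Finset (Finset α) :=
  (chainSets α k).filter fun s => toggles inv s = ∅

theorem card_chainSets_eq (k : ℕ) : (chainSets α k).card =
    (downChains inv k).card + (upChains inv k).card + (criticalChains inv k).card := by
  classical
  rw [← Finset.card_union_of_disjoint, ← Finset.card_union_of_disjoint]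
  · congr 1
    ext s
    simp only [downChains, upChains, criticalChains, Finset.mem_union, Finset.mem_filter]
    constructor
    · intro hs
      by_cases h : (toggles inv s).Nonempty
      · obtain ⟨q, hq⟩ := exists_pivot h
        by_cases hqs : q ∈ s
        · exact Or.inl (Or.inl ⟨hs, q, hqs, hq⟩)
        · exact Or.inl (Or.inr ⟨hs, q, hqs, hq⟩)
      · exact Or.inr ⟨hs, Finset.not_nonempty_iff_eq_empty.1 h⟩
    · rintro ((h | h) | h) <;> exact h.1
  · refine Finset.disjoint_left.2 fun s hs hs' => ?_
    have h' := (Finset.mem_filter.1 hs').2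
    obtain hs | hs := Finset.mem_union.1 hs
    · obtain ⟨q, -, hq⟩ := (Finset.mem_filter.1 hs).2
      simpa [h'] using mem_toggles_of_pivot hq
    · obtain ⟨q, -, hq⟩ := (Finset.mem_filter.1 hs).2
      simpa [h'] using mem_toggles_of_pivot hq
  · refine Finset.disjoint_left.2 fun s hs hs' => ?_
    obtain ⟨q, hqs, hq⟩ := (Finset.mem_filter.1 hs).2
    obtain ⟨q', hqs', hq'⟩ := (Finset.mem_filter.1 hs').2
    rw [hq, Option.some.injEq] at hq'
    exact hqs' (hq' ▸ hqs)

theorem downChains_zero : (downChains inv 0).card = 0 := by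
  classical
  rw [Finset.card_eq_zero, downChains, Finset.filter_eq_empty_iff]
  rintro s hs ⟨q, hq, -⟩
  rw [Finset.card_eq_zero.1 (mem_chainSets.1 hs).2] at hq
  simp at hq

/-- Adding the pivot matches the chains that do not contain it with those that do. -/
theorem IsInversionSystem.card_upChains (h : IsInversionSystem inv) (k : ℕ) :
    (upChains inv k).card = (downChains inv (k + 1)).card := by
  classical
  refine Finset.card_bij' (fun s _ => s ∪ (pivot inv s).toFinset)
    (fun s _ => s \ (pivot inv s).toFinset) ?_ ?_ ?_ ?_
  · intro s hs
    obtain ⟨hs, q, hqs, hq⟩ := Finset.mem_filter.1 hs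
    obtain ⟨hc, hk⟩ := mem_chainSets.1 hs
    have ht := mem_toggles_of_pivot hq
    have heq : s ∪ (pivot inv s).toFinset = insert q s := by rw [hq]; ext; simp
    rw [heq]
    refine Finset.mem_filter.2 ⟨mem_chainSets.2 ⟨isChain_insert_of_mem_toggles hc ht, ?_⟩, q,
      Finset.mem_insert_self _ _, ?_⟩
    · rw [Finset.card_insert_of_notMem hqs, hk]
    · rw [pivot_congr (h.toggles_insert hc ht), hq]
  · intro s hs
    obtain ⟨hs, q, hqs, hq⟩ := Finset.mem_filter.1 hs
    obtain ⟨hc, hk⟩ := mem_chainSets.1 hs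
    have ht := mem_toggles_of_pivot hq
    have heq : s \ (pivot inv s).toFinset = s.erase q := by rw [hq]; ext; simp [and_comm]
    rw [heq]
    refine Finset.mem_filter.2 ⟨mem_chainSets.2 ⟨hc.mono (by simp), ?_⟩, q,
      Finset.notMem_erase _ _, ?_⟩
    · rw [Finset.card_erase_of_mem hqs, hk]
      omega
    · rw [pivot_congr (h.toggles_erase hc ht), hq]
  · intro s hs
    obtain ⟨hs, q, hqs, hq⟩ := Finset.mem_filter.1 hs
    obtain ⟨hc, hk⟩ := mem_chainSets.1 hs
    have ht := mem_toggles_of_pivot hq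
    have heq : s ∪ (pivot inv s).toFinset = insert q s := by rw [hq]; ext; simp
    have hp : pivot inv (s ∪ (pivot inv s).toFinset) = some q := by
      rw [heq, pivot_congr (h.toggles_insert hc ht), hq]
    rw [hp, heq, Option.toFinset_some, ← Finset.erase_eq, Finset.erase_insert hqs]
  · intro s hs
    obtain ⟨hs, q, hqs, hq⟩ := Finset.mem_filter.1 hs
    obtain ⟨hc, hk⟩ := mem_chainSets.1 hs
    have ht := mem_toggles_of_pivot hq
    have heq : s \ (pivot inv s).toFinset = s.erase q := by rw [hq]; ext; simp [and_comm]
    have hp : pivot inv (s \ (pivot inv s).toFinset) = some q := by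
      rw [heq, pivot_congr (h.toggles_erase hc ht), hq]
    rw [hp, heq, Option.toFinset_some, Finset.union_comm, ← Finset.insert_eq,
      Finset.insert_erase hqs]

/-- If a chain `t` with pivot `r ∈ t` contains the chain `s` without its pivot `q ∈ s`, then
either `s = t` or `t` has more inversions than `s`. -/
theorem IsInversionSystem.card_inversions_lt (h : IsInversionSystem inv)
    {s t : Finset α} (hs : IsChain (· ≤ ·) (s : Set α)) (ht : IsChain (· ≤ ·) (t : Set α))
    {q r p : α} (hq : q ∈ s) (hpq : pivot inv s = some q) (hr : r ∈ t)
    (hpr : pivot inv t = some r) (hp : p ∈ t) (hst : t.erase p = s.erase q) (hne : t ≠ s) :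
    (inversions inv s).card < (inversions inv t).card := by
  have hqs := mem_toggles_of_pivot hpq
  have hinv : inversions inv s = inversions inv (s.erase q) := by
    have := inversions_insert_eq_erase hqs
    rwa [Finset.insert_eq_of_mem hq] at this
  have hsub : inversions inv s ⊆ inversions inv t := by
    rw [hinv, ← hst]
    exact inversions_mono (Finset.erase_subset _ _)
  refine Finset.card_lt_card (lt_of_le_of_ne hsub fun heq => hne ?_)
  -- equality of inversion sets means that the extra element of `t` is a toggle of `s.erase q`
  have hpt : p ∈ toggles inv t := by
    refine mem_toggles.2 ⟨fun x hx => ?_, fun i hi => ?_⟩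
    · by_cases hxp : x = p
      · exact Or.inl hxp.le
      · exact ht hx hp hxp
    · have : i ∈ inversions inv (s.erase q) := by
        rw [← hinv, heq]
        exact mem_inversions.2 ⟨p, hp, hi⟩
      rwa [← hst] at this
  have h1 : toggles inv (t.erase p) = toggles inv t :=
    h.toggles_erase ht hpt
  have h2 : toggles inv (s.erase q) = toggles inv s :=
    h.toggles_erase hs hqs
  have hpiv : pivot inv t = pivot inv s := pivot_congr (by rw [← h1, hst, h2])
  have hrq : r = q := by rw [hpr, hpq] at hpiv; exact Option.some.inj hpiv
  have hqp : q = p := by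
    by_contra hqp
    have : q ∈ t.erase p := Finset.mem_erase.2 ⟨hqp, hrq ▸ hr⟩
    rw [hst] at this
    exact Finset.notMem_erase _ _ this
  rw [← Finset.insert_erase hp, hst, ← hqp, Finset.insert_erase hq]

/-- The boundaries of the chains which contain their pivot are linearly independent. -/
theorem IsInversionSystem.card_downChains_le (h : IsInversionSystem inv) (𝕜 : Type*) [Field 𝕜]
    (k : ℕ) : (downChains inv (k + 1)).card ≤
      Module.finrank 𝕜 (LinearMap.range (boundary 𝕜 α k)) := by
  classical
  -- the chains which contain their pivot, and the face obtained by deleting it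
  have hdown : ∀ s : downChains inv (k + 1), ∃ c : Fin (k + 1) ↪o α, ∃ i,
      chainSet c = s.1 ∧ pivot inv s.1 = some (c i) := by
    rintro ⟨s, hs⟩
    obtain ⟨hs, q, hqs, hq⟩ := Finset.mem_filter.1 hs
    obtain ⟨c, hc⟩ := exists_chainSet_eq (mem_chainSets.1 hs).1 (mem_chainSets.1 hs).2
    obtain ⟨i, hi⟩ := mem_chainSet.1 (hc ▸ hqs)
    exact ⟨c, i, hc, hi ▸ hq⟩
  choose c i hc hi using hdown
  have hli : LinearIndependent 𝕜 fun s => boundary 𝕜 α k (chainBasis 𝕜 α (k + 1) (c s)) := by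
    refine linearIndependent_of_triangular _
      (fun s => (chainBasis 𝕜 α k).coord (face (i s) (c s)))
      (fun s => (inversions inv s.1).card) (fun s => coeff_boundary_face 𝕜 _ _)
      fun s t hts hne => ?_
    obtain ⟨j, hj⟩ := exists_face_eq_of_coeff_boundary_ne_zero 𝕜 hne
    have hface := congrArg chainSet hj
    rw [chainSet_face, chainSet_face, hc, hc] at hface
    have hmem : ∀ (u : downChains inv (k + 1)) l, c u l ∈ u.1 := fun u l =>
      hc u ▸ mem_chainSet.2 ⟨l, rfl⟩
    exact h.card_inversions_lt (hc s ▸ isChain_chainSet _) (hc t ▸ isChain_chainSet _) (hmem s _)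
      (hi s) (hmem t _) (hi t) (hmem t j) hface fun h => hts (Subtype.ext h)
  have hspan : Submodule.span 𝕜
      (Set.range fun s => boundary 𝕜 α k (chainBasis 𝕜 α (k + 1) (c s))) ≤
      LinearMap.range (boundary 𝕜 α k) := by
    rw [Submodule.span_le]
    rintro _ ⟨s, rfl⟩
    exact ⟨_, rfl⟩
  have := Submodule.finrank_mono hspan
  rwa [finrank_span_eq_card hli, Fintype.card_coe] at this

variable {N : ℕ}

theorem IsInversionSystem.card_chainSets (h : IsInversionSystem inv)
    (hcrit : ∀ k < N, criticalChains inv k = ∅) {k : ℕ} (hk : k < N) :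
    (chainSets α k).card = (downChains inv k).card + (downChains inv (k + 1)).card := by
  rw [card_chainSets_eq (inv := inv), hcrit k hk, h.card_upChains, Finset.card_empty, add_zero]

/-- If all critical chains have `N` elements, and no chain has more, then the critical chains
count the dimension of the top homology. -/
theorem IsInversionSystem.finrank_reducedHomology (h : IsInversionSystem inv)
    (hcrit : ∀ k < N, criticalChains inv k = ∅) (hN : chainSets α (N + 1) = ∅)
    (𝕜 : Type*) [Field 𝕜] :
    Module.finrank 𝕜 (ReducedHomology 𝕜 α N) = (criticalChains inv N).card := by
  have h1 := finrank_reducedHomology_add_eq 𝕜 downChains_zero (h.card_downChains_le 𝕜)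
    (fun k hk => h.card_chainSets hcrit hk) hN
  have h2 : downChains inv (N + 1) = ∅ := by rw [downChains, hN, Finset.filter_empty]
  rw [card_chainSets_eq (inv := inv), h.card_upChains, h2, Finset.card_empty] at h1
  omega

theorem IsInversionSystem.finrank_reducedHomology_eq_sum (h : IsInversionSystem inv)
    (hcrit : ∀ k < N, criticalChains inv k = ∅) (hN : chainSets α (N + 1) = ∅)
    (𝕜 : Type*) [Field 𝕜] :
    (Module.finrank 𝕜 (ReducedHomology 𝕜 α N) : ℤ) =
      (-1) ^ N * ∑ k ∈ Finset.range (N + 1), (-1) ^ k * ((chainSets α k).card : ℤ) :=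
  ParabolicCosets.finrank_reducedHomology_eq_sum 𝕜 downChains_zero (h.card_downChains_le 𝕜)
    (fun _ hk => h.card_chainSets hcrit hk) hN

end Toggles

/-! ### Inversions of pairs of subsets -/

section PairInversions

variable {n : ℕ}

/-- The pairs `(x, y)` which `A` separates in the wrong order: `x` should precede `y`, as its key
is smaller, but `A` contains `y` and not `x`. -/
def setInversions (κ : Fin n → ℤ) (A : Finset (Fin n)) : Finset (Fin n × Fin n) :=
  Finset.univ.filter fun p => κ p.1 < κ p.2 ∧ p.2 ∈ A ∧ p.1 ∉ A

theorem mem_setInversions {κ : Fin n → ℤ} {A : Finset (Fin n)} {x y : Fin n} :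
    (x, y) ∈ setInversions κ A ↔ κ x < κ y ∧ y ∈ A ∧ x ∉ A := by
  simp [setInversions]

variable [NeZero n]

/-- The increasing key, used for the first component of pairs. -/
def sourceKey (x : Fin n) : ℤ := x

/-- The decreasing key, used for the second component of pairs. -/
def targetKey (x : Fin n) : ℤ := -x

omit [NeZero n] in
theorem sourceKey_injective : Function.Injective (sourceKey (n := n)) :=
  fun x y h => Fin.ext (by simpa [sourceKey] using h)

omit [NeZero n] in
theorem targetKey_injective : Function.Injective (targetKey (n := n)) :=
  fun x y h => Fin.ext (by simpa [targetKey] using h)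

/-- The inversions of a pair `(A, B)`, with respect to the increasing order for `A` and the
decreasing order for `B`. -/
def pairInversions (q : MatchedPair n) : Finset (Fin n × Fin n ⊕ Fin n × Fin n) :=
  (setInversions sourceKey q.1.1).disjSum (setInversions targetKey q.1.2)

/-- The common size of the components of a pair. -/
def MatchedPair.size (q : MatchedPair n) : ℕ := q.1.1.card

theorem MatchedPair.size_pos (q : MatchedPair n) : 0 < q.size :=
  Finset.card_pos.2 ⟨0, q.2.1⟩

theorem MatchedPair.size_lt (q : MatchedPair n) : q.size < n := by
  have := Finset.card_lt_univ_of_notMem (s := q.1.1)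
    (not_forall.1 fun h => q.2.2.1 (Finset.eq_univ_iff_forall.2 h)).choose_spec
  rwa [Fintype.card_fin] at this

theorem MatchedPair.card_fst (q : MatchedPair n) : q.1.1.card = q.size := rfl

theorem MatchedPair.card_snd (q : MatchedPair n) : q.1.2.card = q.size := q.2.2.2.symm

theorem MatchedPair.eq_of_le {p q : MatchedPair n} (h : p ≤ q) (hs : q.size ≤ p.size) : p = q :=
  Subtype.ext (Prod.ext (Finset.eq_of_subset_of_card_le h.1 hs)
    (Finset.eq_of_subset_of_card_le h.2 (by rwa [q.card_snd, p.card_snd])))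

theorem MatchedPair.size_strictMono : StrictMono (MatchedPair.size (n := n)) := fun _ _ h =>
  lt_of_not_ge fun hs => h.ne (MatchedPair.eq_of_le h.le hs)

/-- The properties common to the two components of a pair, which allow both to be treated at
once. -/
structure IsComponent (f : MatchedPair n → Finset (Fin n)) : Prop where
  mono : Monotone f
  card : ∀ q, (f q).card = q.size

theorem isComponent_fst : IsComponent fun q : MatchedPair n => q.1.1 :=
  ⟨fun _ _ h => h.1, MatchedPair.card_fst⟩

theorem isComponent_snd : IsComponent fun q : MatchedPair n => q.1.2 :=
  ⟨fun _ _ h => h.2, MatchedPair.card_snd⟩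

/-- The condition for `q` to be a toggle of `s`, in one component. -/
def IsRedundant (f : MatchedPair n → Finset (Fin n)) (κ : Fin n → ℤ) (s : Finset (MatchedPair n))
    (q : MatchedPair n) : Prop :=
  ∀ x y, κ x < κ y → y ∈ f q → x ∉ f q → ∃ p ∈ s, p ≠ q ∧ y ∈ f p ∧ x ∉ f p

theorem mem_toggles_pairInversions {s : Finset (MatchedPair n)} {q : MatchedPair n} :
    q ∈ toggles pairInversions s ↔ (∀ p ∈ s, p ≤ q ∨ q ≤ p) ∧
      IsRedundant (fun q => q.1.1) sourceKey s q ∧ IsRedundant (fun q => q.1.2) targetKey s q := by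
  rw [mem_toggles]
  refine and_congr_right fun _ => ⟨fun h => ⟨fun x y h1 h2 h3 => ?_, fun x y h1 h2 h3 => ?_⟩,
    fun ⟨h1, h2⟩ i hi => ?_⟩
  · obtain ⟨p, hp, hi⟩ := mem_inversions.1 (h (x := Sum.inl (x, y))
      (Finset.inl_mem_disjSum.2 (mem_setInversions.2 ⟨h1, h2, h3⟩)))
    have := mem_setInversions.1 (Finset.inl_mem_disjSum.1 hi)
    exact ⟨p, Finset.mem_of_mem_erase hp, Finset.ne_of_mem_erase hp, this.2⟩
  · obtain ⟨p, hp, hi⟩ := mem_inversions.1 (h (x := Sum.inr (x, y))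
      (Finset.inr_mem_disjSum.2 (mem_setInversions.2 ⟨h1, h2, h3⟩)))
    have := mem_setInversions.1 (Finset.inr_mem_disjSum.1 hi)
    exact ⟨p, Finset.mem_of_mem_erase hp, Finset.ne_of_mem_erase hp, this.2⟩
  · rcases i with ⟨x, y⟩ | ⟨x, y⟩
    · have hi := mem_setInversions.1 (Finset.inl_mem_disjSum.1 hi)
      obtain ⟨p, hp, hpq, h⟩ := h1 x y hi.1 hi.2.1 hi.2.2
      exact mem_inversions.2 ⟨p, Finset.mem_erase.2 ⟨hpq, hp⟩,
        Finset.inl_mem_disjSum.2 (mem_setInversions.2 ⟨hi.1, h⟩)⟩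
    · have hi := mem_setInversions.1 (Finset.inr_mem_disjSum.1 hi)
      obtain ⟨p, hp, hpq, h⟩ := h2 x y hi.1 hi.2.1 hi.2.2
      exact mem_inversions.2 ⟨p, Finset.mem_erase.2 ⟨hpq, hp⟩,
        Finset.inr_mem_disjSum.2 (mem_setInversions.2 ⟨hi.1, h⟩)⟩

variable {f : MatchedPair n → Finset (Fin n)} {κ : Fin n → ℤ} {s : Finset (MatchedPair n)}

/-- If `x` belongs to `q` only and `z` to `q'` only, then one of `q` and `q'` has them in the wrong
order, and the member of `s` which accounts for this is not comparable to the other one. -/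
theorem IsRedundant.subset_or_subset (hf : IsComponent f) (hκ : Function.Injective κ)
    {q q' : MatchedPair n} (hq : IsRedundant f κ s q) (hq' : IsRedundant f κ s q')
    (hc : ∀ p ∈ s, p ≤ q ∨ q ≤ p) (hc' : ∀ p ∈ s, p ≤ q' ∨ q' ≤ p) :
    f q ⊆ f q' ∨ f q' ⊆ f q := by
  by_contra! h
  obtain ⟨x, hx, hx'⟩ := Finset.not_subset.1 h.1
  obtain ⟨z, hz, hz'⟩ := Finset.not_subset.1 h.2
  have hne : κ x ≠ κ z := fun h => hz' (hκ h ▸ hx)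
  obtain hlt | hlt := lt_or_gt_of_ne hne
  · obtain ⟨p, hp, -, hzp, hxp⟩ := hq' x z hlt hz hx'
    exact (hc p hp).elim (fun h => hz' (hf.mono h hzp)) (fun h => hxp (hf.mono h hx))
  · obtain ⟨p, hp, -, hxp, hzp⟩ := hq z x hlt hx hz'
    exact (hc' p hp).elim (fun h => hx' (hf.mono h hxp)) (fun h => hzp (hf.mono h hz))

/-- An inversion `(x, y)` of both members of `q < q'` comes from a third member of `s`: for `z` in
`q'` and not in `q`, one of the pairs `(z, y)` and `(x, z)` is an inversion, of `q` or of `q'`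
respectively, and a member of `s` which accounts for it also has `(x, y)` as an inversion. -/
theorem IsRedundant.exists_of_lt (hf : IsComponent f) (hκ : Function.Injective κ)
    {q q' : MatchedPair n} (hq : IsRedundant f κ s q) (hq' : IsRedundant f κ s q')
    (hc : ∀ p ∈ s, p ≤ q ∨ q ≤ p) (hc' : ∀ p ∈ s, p ≤ q' ∨ q' ≤ p) (hlt : q < q')
    {x y : Fin n} (hxy : κ x < κ y) (hy : y ∈ f q) (hx : x ∉ f q') :
    ∃ p ∈ s, p ≠ q ∧ p ≠ q' ∧ y ∈ f p ∧ x ∉ f p := by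
  obtain ⟨z, hz, hz'⟩ := Finset.exists_mem_notMem_of_card_lt_card (s := f q) (t := f q')
    (by rw [hf.card, hf.card]; exact MatchedPair.size_strictMono hlt)
  have hne : κ z ≠ κ y := fun h => hz' (hκ h ▸ hy)
  obtain h | h := lt_or_gt_of_ne hne
  · obtain ⟨p, hp, hpq, hyp, hzp⟩ := hq z y h hy hz'
    refine ⟨p, hp, hpq, fun h => hzp (h ▸ hz), hyp, fun hxp => ?_⟩
    exact (hc' p hp).elim (fun h => hx (hf.mono h hxp)) (fun h => hzp (hf.mono h hz))
  · obtain ⟨p, hp, hpq, hzp, hxp⟩ := hq' x z (hxy.trans h) hz hx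
    refine ⟨p, hp, fun h => hz' (h ▸ hzp), hpq, ?_, hxp⟩
    exact (hc p hp).elim (fun h => absurd (hf.mono h hzp) hz') (fun h => hf.mono h hy)

theorem IsRedundant.exists_ne (hf : IsComponent f) (hκ : Function.Injective κ)
    {q q' : MatchedPair n} (hq : IsRedundant f κ s q) (hq' : IsRedundant f κ s q')
    (hc : ∀ p ∈ s, p ≤ q ∨ q ≤ p) (hc' : ∀ p ∈ s, p ≤ q' ∨ q' ≤ p) (hqq : q ≤ q' ∨ q' ≤ q)
    (hne : q ≠ q') {x y : Fin n} (hxy : κ x < κ y) (hy : y ∈ f q) (hx : x ∉ f q) :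
    ∃ p ∈ s, p ≠ q ∧ p ≠ q' ∧ y ∈ f p ∧ x ∉ f p := by
  obtain ⟨p, hp, hpq, hyp, hxp⟩ := hq x y hxy hy hx
  by_cases hpq' : p = q'
  · subst hpq'
    obtain h | h := hqq
    · exact hq.exists_of_lt hf hκ hq' hc hc' (lt_of_le_of_ne h hne) hxy hy hxp
    · obtain ⟨r, hr, h1, h2, h3⟩ :=
        hq'.exists_of_lt hf hκ hq hc' hc (lt_of_le_of_ne h hne.symm) hxy hyp hx
      exact ⟨r, hr, h2, h1, h3⟩
  · exact ⟨p, hp, hpq, hpq', hyp, hxp⟩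

theorem isInversionSystem_pairInversions :
    IsInversionSystem (pairInversions (n := n)) := by
  have hcomp : ∀ {s : Finset (MatchedPair n)} {q q' : MatchedPair n},
      q ∈ toggles pairInversions s → q' ∈ toggles pairInversions s → q ≤ q' ∨ q' ≤ q := by
    intro s q q' hq hq'
    obtain ⟨hc, h1, h2⟩ := mem_toggles_pairInversions.1 hq
    obtain ⟨hc', h1', h2'⟩ := mem_toggles_pairInversions.1 hq'
    have hsize : ∀ {p p' : MatchedPair n}, p.1.1 ⊆ p'.1.1 → p'.1.2 ⊆ p.1.2 → p = p' := by
      intro p p' ha hb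
      have hle := Finset.card_le_card ha
      have hle' := Finset.card_le_card hb
      rw [p.card_snd, p'.card_snd] at hle'
      refine Subtype.ext (Prod.ext (Finset.eq_of_subset_of_card_le ha hle')
        (Finset.eq_of_subset_of_card_le hb ?_).symm)
      rwa [p.card_snd, p'.card_snd]
    rcases h1.subset_or_subset isComponent_fst sourceKey_injective h1' hc hc' with ha | ha <;>
    rcases h2.subset_or_subset isComponent_snd targetKey_injective h2' hc hc' with hb | hb
    · exact Or.inl ⟨ha, hb⟩
    · exact Or.inl (hsize ha hb).le
    · exact Or.inr (hsize ha hb).le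
    · exact Or.inr ⟨ha, hb⟩
  refine ⟨fun _ => hcomp, fun {s} _ {q q'} hq hq' hne i hi => ?_⟩
  have hqq := hcomp hq hq'
  obtain ⟨hc, h1, h2⟩ := mem_toggles_pairInversions.1 hq
  obtain ⟨hc', h1', h2'⟩ := mem_toggles_pairInversions.1 hq'
  rcases i with ⟨x, y⟩ | ⟨x, y⟩
  · obtain ⟨hxy, hy, hx⟩ := mem_setInversions.1 (Finset.inl_mem_disjSum.1 hi)
    obtain ⟨p, hp, hpq, hpq', h⟩ :=
      h1.exists_ne isComponent_fst sourceKey_injective h1' hc hc' hqq hne hxy hy hx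
    exact ⟨p, hp, hpq, hpq', Finset.inl_mem_disjSum.2 (mem_setInversions.2 ⟨hxy, h⟩)⟩
  · obtain ⟨hxy, hy, hx⟩ := mem_setInversions.1 (Finset.inr_mem_disjSum.1 hi)
    obtain ⟨p, hp, hpq, hpq', h⟩ :=
      h2.exists_ne isComponent_snd targetKey_injective h2' hc hc' hqq hne hxy hy hx
    exact ⟨p, hp, hpq, hpq', Finset.inr_mem_disjSum.2 (mem_setInversions.2 ⟨hxy, h⟩)⟩

/-! #### Critical chains are maximal -/

omit [NeZero n] in
/-- Between nested sets there is one of any intermediate size, obtained by adding the elements with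
the smallest keys. -/
theorem exists_initial_between (κ : Fin n → ℤ) {A B : Finset (Fin n)} (hAB : A ⊆ B) {m : ℕ}
    (hA : A.card ≤ m) (hB : m ≤ B.card) :
    ∃ t, A ⊆ t ∧ t ⊆ B ∧ t.card = m ∧ ∀ x ∈ B, x ∉ t → ∀ y ∈ t, y ∉ A → κ y ≤ κ x := by
  induction m, hA using Nat.le_induction with
  | base => exact ⟨A, subset_rfl, hAB, rfl, fun x _ _ y hy hy' => absurd hy hy'⟩
  | succ m hm ih =>
    obtain ⟨t, hAt, htB, hcard, ht⟩ := ih (by omega)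
    obtain ⟨z, hz, hmin⟩ := (B \ t).exists_min_image κ (by
      rw [← Finset.card_pos, Finset.card_sdiff_of_subset htB]
      omega)
    obtain ⟨hzB, hzt⟩ := Finset.mem_sdiff.1 hz
    refine ⟨insert z t, hAt.trans (Finset.subset_insert _ _), Finset.insert_subset hzB htB,
      by rw [Finset.card_insert_of_notMem hzt, hcard], fun x hx hxt y hy hyA => ?_⟩
    have hxt' : x ∉ t := fun h => hxt (Finset.mem_insert_of_mem h)
    obtain rfl | hy := Finset.mem_insert.1 hy
    · exact hmin x (Finset.mem_sdiff.2 ⟨hx, hxt'⟩)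
    · exact ht x hx hxt' y hy hyA

/-- A chain without a member of size `m` has room for a set of size `m` that creates no
inversion. -/
theorem exists_interpolant (hf : IsComponent f) (κ : Fin n → ℤ)
    (hs : IsChain (· ≤ ·) (s : Set (MatchedPair n))) {m : ℕ} (hm : m ≤ n) :
    ∃ t : Finset (Fin n), t.card = m ∧ (∀ p ∈ s, p.size < m → f p ⊆ t) ∧
      (∀ p ∈ s, m < p.size → t ⊆ f p) ∧
      ∀ x y, κ x < κ y → y ∈ t → x ∉ t → ∃ p ∈ s, p.size ≠ m ∧ y ∈ f p ∧ x ∉ f p := by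
  classical
  let A : Finset (Fin n) := (s.filter fun p => p.size < m).biUnion f
  let B : Finset (Fin n) := Finset.univ.filter fun x => ∀ p ∈ s, m < p.size → x ∈ f p
  have hmono : ∀ p ∈ s, ∀ p' ∈ s, p.size ≤ p'.size → f p ⊆ f p' := by
    intro p hp p' hp' hle
    obtain rfl | hne := eq_or_ne p p'
    · exact subset_rfl
    · obtain h | h := hs hp hp' hne
      · exact hf.mono h
      · rw [MatchedPair.eq_of_le h hle]
  have hAB : A ⊆ B := by
    intro y hy
    obtain ⟨p, hp, hyp⟩ := Finset.mem_biUnion.1 hy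
    obtain ⟨hp, hpm⟩ := Finset.mem_filter.1 hp
    exact Finset.mem_filter.2 ⟨Finset.mem_univ _, fun p' hp' hpm' =>
      hmono p hp p' hp' (by omega) hyp⟩
  have hA : A.card ≤ m := by
    obtain h | h := (s.filter fun p => p.size < m).eq_empty_or_nonempty
    · simp [A, h]
    · obtain ⟨p, hp, hmax⟩ := Finset.exists_max_image _ MatchedPair.size h
      obtain ⟨hps, hpm⟩ := Finset.mem_filter.1 hp
      have : A ⊆ f p := Finset.biUnion_subset.2 fun p' hp' =>
        hmono p' (Finset.mem_filter.1 hp').1 p hps (hmax p' hp')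
      exact (Finset.card_le_card this).trans (by rw [hf.card]; exact hpm.le)
  have hB : m ≤ B.card := by
    obtain h | h := (s.filter fun p => m < p.size).eq_empty_or_nonempty
    · have : B = Finset.univ := Finset.filter_true_of_mem fun x _ p hp hpm =>
        absurd (Finset.mem_filter.2 ⟨hp, hpm⟩) (h ▸ Finset.notMem_empty p)
      rw [this]
      simpa using hm
    · obtain ⟨p, hp, hmin⟩ := Finset.exists_min_image _ MatchedPair.size h
      obtain ⟨hps, hpm⟩ := Finset.mem_filter.1 hp
      have : f p ⊆ B := fun x hx => Finset.mem_filter.2 ⟨Finset.mem_univ _, fun p' hp' hpm' =>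
        hmono p hps p' hp' (hmin p' (Finset.mem_filter.2 ⟨hp', hpm'⟩)) hx⟩
      exact le_trans (by rw [hf.card]; exact hpm.le) (Finset.card_le_card this)
  obtain ⟨t, hAt, htB, hcard, ht⟩ := exists_initial_between κ hAB hA hB
  have hlow : ∀ p ∈ s, p.size < m → f p ⊆ t := fun p hp hpm =>
    (Finset.subset_biUnion_of_mem f (Finset.mem_filter.2 ⟨hp, hpm⟩)).trans hAt
  have hhigh : ∀ p ∈ s, m < p.size → t ⊆ f p := fun p hp hpm x hx =>
    (Finset.mem_filter.1 (htB hx)).2 p hp hpm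
  refine ⟨t, hcard, hlow, hhigh, fun x y hxy hy hx => ?_⟩
  by_cases hyA : y ∈ A
  · obtain ⟨p, hp, hyp⟩ := Finset.mem_biUnion.1 hyA
    obtain ⟨hp, hpm⟩ := Finset.mem_filter.1 hp
    exact ⟨p, hp, hpm.ne, hyp, fun hxp => hx (hlow p hp hpm hxp)⟩
  · have hxB : x ∉ B := fun hxB => absurd (ht x hxB hx y hy hyA) (not_le.2 hxy)
    rw [Finset.mem_filter] at hxB
    push Not at hxB
    obtain ⟨p, hp, hpm, hxp⟩ := hxB (Finset.mem_univ _)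
    exact ⟨p, hp, hpm.ne', hhigh p hp hpm hy, hxp⟩

theorem toggles_nonempty_of_size_ne (hs : IsChain (· ≤ ·) (s : Set (MatchedPair n))) {m : ℕ}
    (h0 : 0 < m) (hm : m < n) (hsm : ∀ p ∈ s, p.size ≠ m) :
    (toggles pairInversions s).Nonempty := by
  obtain ⟨A, hA, hlA, huA, hiA⟩ := exists_interpolant isComponent_fst sourceKey hs hm.le
  obtain ⟨B, hB, hlB, huB, hiB⟩ := exists_interpolant isComponent_snd targetKey hs hm.le
  have hzero : (0 : Fin n) ∈ A := by
    by_contra h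
    obtain ⟨y, hy⟩ := Finset.card_pos.1 (hA ▸ h0)
    have hy0 : y ≠ 0 := fun h' => h (h' ▸ hy)
    obtain ⟨p, -, -, -, hp⟩ := hiA 0 y (by
      have := Fin.pos_iff_ne_zero.2 hy0
      simpa [sourceKey] using this) hy h
    exact hp p.2.1
  let q : MatchedPair n := ⟨(A, B), hzero, fun h => by
    have h : A = Finset.univ := h
    rw [h, Finset.card_univ, Fintype.card_fin] at hA
    omega, by rw [hA, hB]⟩
  have hq : q.size = m := hA
  refine ⟨q, mem_toggles_pairInversions.2 ⟨fun p hp => ?_, fun x y hxy hy hx => ?_,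
    fun x y hxy hy hx => ?_⟩⟩
  · obtain h | h := lt_or_gt_of_ne (hsm p hp)
    · exact Or.inl ⟨hlA p hp h, hlB p hp h⟩
    · exact Or.inr ⟨huA p hp h, huB p hp h⟩
  · obtain ⟨p, hp, hpm, h⟩ := hiA x y hxy hy hx
    exact ⟨p, hp, fun h => hpm (h ▸ hq), h⟩
  · obtain ⟨p, hp, hpm, h⟩ := hiB x y hxy hy hx
    exact ⟨p, hp, fun h => hpm (h ▸ hq), h⟩

theorem size_injOn_of_isChain (hs : IsChain (· ≤ ·) (s : Set (MatchedPair n))) :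
    Set.InjOn MatchedPair.size (s : Set (MatchedPair n)) := by
  intro p hp q hq h
  by_contra hne
  obtain h' | h' := hs hp hq hne
  · exact hne (MatchedPair.eq_of_le h' h.ge)
  · exact hne (MatchedPair.eq_of_le h' h.le).symm

theorem image_size_subset (s : Finset (MatchedPair n)) :
    s.image MatchedPair.size ⊆ Finset.Icc 1 (n - 1) := by
  intro m hm
  obtain ⟨p, -, rfl⟩ := Finset.mem_image.1 hm
  have h1 := p.size_pos
  have h2 := p.size_lt
  exact Finset.mem_Icc.2 ⟨h1, by omega⟩

theorem criticalChains_eq_empty {k : ℕ} (hk : k < n - 1) :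
    criticalChains (pairInversions (n := n)) k = ∅ := by
  classical
  rw [criticalChains, Finset.filter_eq_empty_iff]
  intro s hs hcrit
  obtain ⟨hs, hcard⟩ := mem_chainSets.1 hs
  obtain ⟨m, hm, hms⟩ := Finset.exists_mem_notMem_of_card_lt_card
    (s := s.image MatchedPair.size) (t := Finset.Icc 1 (n - 1)) (by
      rw [Finset.card_image_of_injOn (size_injOn_of_isChain hs), Nat.card_Icc]
      omega)
  rw [Finset.mem_Icc] at hm
  exact (toggles_nonempty_of_size_ne hs (m := m) (by omega) (by omega)
    fun p hp h => hms (Finset.mem_image.2 ⟨p, hp, h⟩)).ne_empty hcrit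

theorem chainSets_eq_empty : chainSets (MatchedPair n) (n - 1 + 1) = ∅ := by
  classical
  refine Finset.eq_empty_of_forall_notMem fun s hs => ?_
  obtain ⟨hs, hcard⟩ := mem_chainSets.1 hs
  have := Finset.card_le_card (image_size_subset s)
  rw [Finset.card_image_of_injOn (size_injOn_of_isChain hs), Nat.card_Icc] at this
  omega

end PairInversions

/-! ### Length and descents of permutations -/

section Descents

variable {n : ℕ}

/-- The inversions of a permutation, as pairs of positions. -/
def permInversions (w : Equiv.Perm (Fin n)) : Finset (Fin n × Fin n) :=
  Finset.univ.filter fun p => p.1 < p.2 ∧ w p.2 < w p.1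

theorem mem_permInversions {w : Equiv.Perm (Fin n)} {a b : Fin n} :
    (a, b) ∈ permInversions w ↔ a < b ∧ w b < w a := by
  simp [permInversions]

theorem swap_lt_swap {i j a b : Fin n} (hij : (j : ℕ) = i + 1) (hab : a < b)
    (hne : ¬ (a = i ∧ b = j)) : Equiv.swap i j a < Equiv.swap i j b := by
  simp only [Equiv.swap_apply_def]
  split_ifs <;> simp only [Fin.ext_iff, Fin.lt_def] at * <;> omega

/-- Multiplication by an adjacent transposition at an ascent adds one inversion. -/
theorem card_permInversions_mul_swap {w : Equiv.Perm (Fin n)} {i j : Fin n}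
    (hij : (j : ℕ) = i + 1) (hw : w i < w j) :
    (permInversions (w * Equiv.swap i j)).card = (permInversions w).card + 1 := by
  have hlt : i < j := Fin.lt_def.2 (by omega)
  have hmem : (i, j) ∈ permInversions (w * Equiv.swap i j) :=
    mem_permInversions.2 ⟨hlt, by simpa using hw⟩
  rw [← Finset.card_erase_add_one hmem, add_left_inj]
  symm
  refine Finset.card_bij' (fun p _ => (Equiv.swap i j p.1, Equiv.swap i j p.2))
    (fun p _ => (Equiv.swap i j p.1, Equiv.swap i j p.2)) ?_ ?_ ?_ ?_
  · rintro ⟨a, b⟩ h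
    obtain ⟨hab, h⟩ := mem_permInversions.1 h
    refine Finset.mem_erase.2 ⟨fun heq => ?_, mem_permInversions.2
      ⟨swap_lt_swap hij hab ?_, by simpa using h⟩⟩
    · have h1 : Equiv.swap i j a = i := congrArg Prod.fst heq
      have h2 : Equiv.swap i j b = j := congrArg Prod.snd heq
      rw [Equiv.swap_apply_eq_iff, Equiv.swap_apply_left] at h1
      rw [Equiv.swap_apply_eq_iff, Equiv.swap_apply_right] at h2
      exact absurd hab (by rw [h1, h2]; exact hlt.asymm)
    · rintro ⟨rfl, rfl⟩
      exact hw.asymm h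
  · rintro ⟨a, b⟩ h
    obtain ⟨hne, h⟩ := Finset.mem_erase.1 h
    obtain ⟨hab, h⟩ := mem_permInversions.1 h
    refine mem_permInversions.2 ⟨swap_lt_swap hij hab ?_, by simpa using h⟩
    rintro ⟨rfl, rfl⟩
    exact hne rfl
  · rintro ⟨a, b⟩ _
    simp
  · rintro ⟨a, b⟩ _
    simp

theorem card_permInversions_mul_swap_of_gt {w : Equiv.Perm (Fin n)} {i j : Fin n}
    (hij : (j : ℕ) = i + 1) (hw : w j < w i) :
    (permInversions (w * Equiv.swap i j)).card + 1 = (permInversions w).card := by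
  rw [← card_permInversions_mul_swap hij (by simpa using hw), Equiv.mul_swap_mul_self]

theorem apply_ne_of_adjacent (w : Equiv.Perm (Fin n)) {i j : Fin n} (hij : (j : ℕ) = i + 1) :
    w i ≠ w j := fun h => by
  have := w.injective h
  rw [this] at hij
  omega

theorem card_permInversions_prod_le (l : List (Equiv.Perm (Fin n)))
    (hl : ∀ s ∈ l, s ∈ simpleReflections n) : (permInversions l.prod).card ≤ l.length := by
  induction l using List.reverseRecOn with
  | nil =>
    simp only [List.prod_nil, List.length_nil, Nat.le_zero, Finset.card_eq_zero]
    refine Finset.eq_empty_of_forall_notMem fun p hp => ?_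
    obtain ⟨h1, h2⟩ := mem_permInversions.1 hp
    exact h1.asymm h2
  | append_singleton l s ih =>
    obtain ⟨i, j, hij, rfl⟩ := hl s (by simp)
    have ih := ih fun s hs => hl s (by simp [hs])
    rw [List.prod_append, List.prod_singleton, List.length_append, List.length_singleton]
    obtain h | h := lt_or_gt_of_ne (apply_ne_of_adjacent l.prod hij)
    · rw [card_permInversions_mul_swap hij h]
      omega
    · have := card_permInversions_mul_swap_of_gt hij h
      omega

theorem exists_descent {w : Equiv.Perm (Fin n)} (hw : w ≠ 1) :
    ∃ i j : Fin n, (j : ℕ) = i + 1 ∧ w j < w i := by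
  by_contra! h
  refine hw ?_
  have hmono : StrictMono w := by
    cases n with
    | zero => exact fun i => i.elim0
    | succ n =>
      refine Fin.strictMono_iff_lt_succ.2 fun i => ?_
      have hi : ((i.succ : Fin (n + 1)) : ℕ) = (i.castSucc : ℕ) + 1 := by simp
      exact lt_of_le_of_ne (h _ _ hi) (apply_ne_of_adjacent w hi)
  have hrange : Set.range w = Set.range (id : Fin n → Fin n) := by
    rw [w.surjective.range_eq, Set.range_id]
  exact Equiv.ext fun x => congrFun ((StrictMono.range_inj hmono strictMono_id).1 hrange) x

theorem exists_word (w : Equiv.Perm (Fin n)) : ∃ l : List (Equiv.Perm (Fin n)),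
    (∀ s ∈ l, s ∈ simpleReflections n) ∧ l.prod = w ∧ l.length = (permInversions w).card := by
  induction hk : (permInversions w).card generalizing w with
  | zero =>
    refine ⟨[], by simp, ?_, rfl⟩
    by_contra hne
    obtain ⟨i, j, hij, h⟩ := exists_descent (Ne.symm hne)
    have := card_permInversions_mul_swap_of_gt hij h
    omega
  | succ k ih =>
    have hne : w ≠ 1 := by
      rintro rfl
      have := card_permInversions_prod_le (n := n) [] (by simp)
      rw [List.prod_nil, hk] at this
      simp at this
    obtain ⟨i, j, hij, h⟩ := exists_descent hne
    have hcard := card_permInversions_mul_swap_of_gt hij h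
    obtain ⟨l, hl, hprod, hlen⟩ := ih (w * Equiv.swap i j) (by omega)
    refine ⟨l ++ [Equiv.swap i j], fun s hs => ?_, ?_, by simp [hlen]⟩
    · obtain hs | hs := List.mem_append.1 hs
      · exact hl s hs
      · exact ⟨i, j, hij, List.mem_singleton.1 hs⟩
    · rw [List.prod_append, List.prod_singleton, hprod, Equiv.mul_swap_mul_self]

/-- The Coxeter length is the number of inversions. -/
theorem length_eq_card_permInversions (w : Equiv.Perm (Fin n)) :
    length w = (permInversions w).card := by
  refine le_antisymm (Nat.sInf_le (exists_word w)) (le_csInf ⟨_, exists_word w⟩ ?_)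
  rintro _ ⟨l, hl, rfl, rfl⟩
  exact card_permInversions_prod_le l hl

theorem swap_mem_des {w : Equiv.Perm (Fin n)} {i j : Fin n} (hij : (j : ℕ) = i + 1) :
    Equiv.swap i j ∈ des w ↔ w j < w i := by
  have hs : Equiv.swap i j ∈ simpleReflections n := ⟨i, j, hij, rfl⟩
  rw [des, Set.mem_sep_iff, length_eq_card_permInversions, length_eq_card_permInversions]
  obtain h | h := lt_or_gt_of_ne (apply_ne_of_adjacent w hij)
  · have := card_permInversions_mul_swap hij h
    exact iff_of_false (fun h' => by omega) h.asymm
  · have := card_permInversions_mul_swap_of_gt hij h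
    exact iff_of_true ⟨hs, by omega⟩ h

theorem des_subset_des_iff {v w : Equiv.Perm (Fin n)} :
    des v ⊆ des w ↔ ∀ i j : Fin n, (j : ℕ) = i + 1 → v j < v i → w j < w i := by
  constructor
  · intro h i j hij hv
    exact (swap_mem_des hij).1 (h ((swap_mem_des hij).2 hv))
  · rintro h s hs
    obtain ⟨i, j, hij, rfl⟩ := hs.1
    exact (swap_mem_des hij).2 (h i j hij ((swap_mem_des hij).1 hs))

end Descents

/-! ### Critical chains and pairs of permutations -/

section Critical

variable {n : ℕ} [NeZero n]

/-- The `m`-th set of a complete flag, as the set of the first `m` values of `w`. -/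
def prefixSet (w : Equiv.Perm (Fin n)) (m : ℕ) : Finset (Fin n) :=
  Finset.univ.filter fun x => (w.symm x : ℕ) < m

omit [NeZero n] in
theorem mem_prefixSet {w : Equiv.Perm (Fin n)} {m : ℕ} {x : Fin n} :
    x ∈ prefixSet w m ↔ (w.symm x : ℕ) < m := by
  simp [prefixSet]

omit [NeZero n] in
theorem apply_mem_prefixSet {w : Equiv.Perm (Fin n)} {m : ℕ} {a : Fin n} :
    w a ∈ prefixSet w m ↔ (a : ℕ) < m := by
  rw [mem_prefixSet, Equiv.symm_apply_apply]

omit [NeZero n] in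
theorem card_prefixSet (w : Equiv.Perm (Fin n)) {m : ℕ} (hm : m ≤ n) :
    (prefixSet w m).card = m := by
  have h : prefixSet w m = (Finset.univ.filter fun a : Fin n => (a : ℕ) < m).map w.toEmbedding := by
    ext x
    simp [mem_prefixSet]
  rw [h, Finset.card_map, Fin.card_filter_val_lt, min_eq_right hm]

/-- The pair formed by the sets of the first `i + 1` values of `τ` and of `σ`. -/
def prefixPair (σ τ : Equiv.Perm (Fin n)) (h : τ 0 = 0) (i : Fin (n - 1)) : MatchedPair n :=
  ⟨(prefixSet τ (i + 1), prefixSet σ (i + 1)), by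
    have hi : (i : ℕ) + 1 < n := by omega
    refine ⟨?_, fun huniv => ?_, ?_⟩
    · have := (apply_mem_prefixSet (w := τ) (m := i + 1) (a := 0)).2 (by simp)
      rwa [h] at this
    · have := congrArg Finset.card huniv
      rw [card_prefixSet τ hi.le, Finset.card_univ, Fintype.card_fin] at this
      omega
    · rw [card_prefixSet τ hi.le, card_prefixSet σ hi.le]⟩

theorem size_prefixPair (σ τ : Equiv.Perm (Fin n)) (h : τ 0 = 0) (i : Fin (n - 1)) :
    (prefixPair σ τ h i).size = i + 1 :=
  card_prefixSet τ (by omega)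

/-- The maximal chain of pairs given by two permutations. -/
def prefixChain (σ τ : Equiv.Perm (Fin n)) (h : τ 0 = 0) : Fin (n - 1) ↪o MatchedPair n :=
  OrderEmbedding.ofStrictMono (prefixPair σ τ h) fun i j hij => by
    have hij' : (i : ℕ) < j := hij
    refine lt_of_le_of_ne ⟨fun x hx => ?_, fun x hx => ?_⟩ fun heq => ?_
    · exact mem_prefixSet.2 ((mem_prefixSet.1 hx).trans (by omega))
    · exact mem_prefixSet.2 ((mem_prefixSet.1 hx).trans (by omega))
    · have := congrArg MatchedPair.size heq
      rw [size_prefixPair, size_prefixPair] at this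
      omega

theorem prefixChain_fst (σ τ : Equiv.Perm (Fin n)) (h : τ 0 = 0) (i : Fin (n - 1)) :
    (prefixChain σ τ h i).1.1 = prefixSet τ (i + 1) := rfl

theorem prefixChain_snd (σ τ : Equiv.Perm (Fin n)) (h : τ 0 = 0) (i : Fin (n - 1)) :
    (prefixChain σ τ h i).1.2 = prefixSet σ (i + 1) := rfl

/-- The `i`-th member of a complete flag is redundant if and only if the keys increase at the `i`-th
position. -/
theorem isRedundant_iff {f : MatchedPair n → Finset (Fin n)} {κ : Fin n → ℤ}
    (c : Fin (n - 1) ↪o MatchedPair n) (w : Equiv.Perm (Fin n))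
    (hc : ∀ i, f (c i) = prefixSet w (i + 1)) (hκ : Function.Injective κ) (i : Fin (n - 1))
    {a b : Fin n} (ha : (a : ℕ) = i) (hb : (b : ℕ) = i + 1) :
    IsRedundant f κ (chainSet c) (c i) ↔ κ (w a) < κ (w b) := by
  constructor
  · intro h
    by_contra hle
    have hne : w a ≠ w b := apply_ne_of_adjacent w (by omega)
    have hlt : κ (w b) < κ (w a) := lt_of_le_of_ne (not_lt.1 hle) fun h => hne (hκ h).symm
    obtain ⟨p, hp, hpi, h1, h2⟩ := h (w b) (w a) hlt
      (by rw [hc, apply_mem_prefixSet]; omega) (by rw [hc, apply_mem_prefixSet]; omega)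
    obtain ⟨j, rfl⟩ := mem_chainSet.1 hp
    rw [hc, apply_mem_prefixSet] at h1 h2
    exact hpi (congrArg c (Fin.ext (by omega)))
  · intro h x y hxy hy hx
    obtain ⟨x, rfl⟩ := w.surjective x
    obtain ⟨y, rfl⟩ := w.surjective y
    rw [hc, apply_mem_prefixSet] at hx hy
    have hj : ∃ j : Fin (n - 1), j ≠ i ∧ (y : ℕ) < j + 1 ∧ ¬ (x : ℕ) < j + 1 := by
      by_cases hya : y = a
      · have hxb : x ≠ b := by
          rintro rfl
          rw [hya] at hxy
          exact hxy.asymm h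
        have : (x : ℕ) ≠ b := fun h => hxb (Fin.ext h)
        refine ⟨⟨i + 1, by omega⟩, fun h => ?_, by dsimp only; omega, by dsimp only; omega⟩
        have := congrArg Fin.val h
        dsimp only at this
        omega
      · have : (y : ℕ) ≠ a := fun h => hya (Fin.ext h)
        refine ⟨⟨i - 1, by omega⟩, fun h => ?_, by dsimp only; omega, by dsimp only; omega⟩
        have := congrArg Fin.val h
        dsimp only at this
        omega
    obtain ⟨j, hji, hyj, hxj⟩ := hj
    refine ⟨c j, mem_chainSet.2 ⟨j, rfl⟩, fun h => hji (c.injective h), ?_, ?_⟩ <;>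
      rwa [hc, apply_mem_prefixSet]

theorem toggles_prefixChain_eq_empty (σ τ : Equiv.Perm (Fin n)) (h : τ 0 = 0) :
    toggles pairInversions (chainSet (prefixChain σ τ h)) = ∅ ↔ des σ ⊆ des τ := by
  have hredundant : ∀ (i : Fin (n - 1)) (a b : Fin n), (a : ℕ) = i → (b : ℕ) = i + 1 →
      (prefixChain σ τ h i ∈ toggles pairInversions (chainSet (prefixChain σ τ h)) ↔
        τ a < τ b ∧ σ b < σ a) := by
    intro i a b ha hb
    rw [mem_toggles_pairInversions,
      isRedundant_iff _ τ (prefixChain_fst σ τ h) sourceKey_injective i ha hb,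
      isRedundant_iff _ σ (prefixChain_snd σ τ h) targetKey_injective i ha hb, and_iff_right]
    · simp [sourceKey, targetKey]
    · intro p hp
      obtain ⟨j, rfl⟩ := mem_chainSet.1 hp
      exact (le_total j i).imp (fun h' => (prefixChain σ τ h).monotone h')
        (fun h' => (prefixChain σ τ h).monotone h')
  rw [des_subset_des_iff, Finset.eq_empty_iff_forall_notMem]
  constructor
  · intro hempty a b hab hσ
    have ha : (a : ℕ) < n - 1 := by omega
    refine lt_of_le_of_ne (not_lt.1 fun hτ => ?_) (apply_ne_of_adjacent τ hab).symm
    exact hempty _ ((hredundant ⟨a, ha⟩ a b rfl hab).2 ⟨hτ, hσ⟩)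
  · intro hdes q hq
    -- a toggle is comparable to the member of the same size, hence equal to it
    have h1 := q.size_pos
    have h2 := q.size_lt
    let i : Fin (n - 1) := ⟨q.size - 1, by omega⟩
    have hsize : (prefixChain σ τ h i).size = q.size := by
      refine (size_prefixPair σ τ h i).trans ?_
      change q.size - 1 + 1 = q.size
      omega
    have heq : prefixChain σ τ h i = q := by
      obtain hle | hle := (mem_toggles_pairInversions.1 hq).1 _ (mem_chainSet.2 ⟨i, rfl⟩)
      · exact MatchedPair.eq_of_le hle hsize.ge
      · exact (MatchedPair.eq_of_le hle hsize.le).symm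
    have hi : (i : ℕ) < n - 1 := i.2
    have hred := (hredundant i ⟨i, by omega⟩ ⟨i + 1, by omega⟩ rfl rfl).1 (heq ▸ hq)
    exact hred.1.asymm (hdes _ _ rfl hred.2)

omit [NeZero n] in
/-- A permutation is determined by its complete flag. -/
theorem eq_of_prefixSet_eq {v w : Equiv.Perm (Fin n)}
    (h : ∀ m < n - 1, prefixSet v (m + 1) = prefixSet w (m + 1)) : v = w := by
  have hsymm : ∀ m x, (v.symm x : ℕ) < m ↔ (w.symm x : ℕ) < m := by
    intro m x
    have hv := (v.symm x).2
    have hw := (w.symm x).2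
    by_cases hm : m < n
    · cases m with
      | zero => simp
      | succ m => rw [← mem_prefixSet, ← mem_prefixSet, h m (by omega)]
    · exact iff_of_true (by omega) (by omega)
  have : v.symm = w.symm := Equiv.ext fun x => Fin.ext <| by
    have h1 := hsymm (v.symm x + 1) x
    have h2 := hsymm (w.symm x + 1) x
    omega
  rw [← v.symm_symm, this, w.symm_symm]

/-- The members of a chain with `n - 1` elements have the sizes `1, …, n - 1`. -/
theorem size_chain (c : Fin (n - 1) ↪o MatchedPair n) (i : Fin (n - 1)) :
    (c i).size = i + 1 := by
  have hpos : ∀ i, 0 < (c i).size := fun i => (c i).size_pos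
  have hlt : ∀ i, (c i).size < n := fun i => (c i).size_lt
  let g : Fin (n - 1) → Fin (n - 1) := fun i =>
    ⟨(c i).size - 1, by have := hpos i; have := hlt i; omega⟩
  have hg : StrictMono g := fun i j hij => by
    have h1 := MatchedPair.size_strictMono (c.strictMono hij)
    have h2 := hpos i
    exact Fin.lt_def.2 (by simp only [g]; omega)
  have hrange : Set.range g = Set.range (id : Fin (n - 1) → Fin (n - 1)) := by
    rw [(Finite.surjective_of_injective hg.injective).range_eq, Set.range_id]
  have h1 := congrArg Fin.val (congrFun ((StrictMono.range_inj hg strictMono_id).1 hrange) i)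
  have h2 : (g i : ℕ) = (c i).size - 1 := rfl
  have h3 := hpos i
  rw [h2, id] at h1
  omega

omit [NeZero n] in
/-- Every complete flag comes from a permutation. -/
theorem exists_perm_prefixSet {A : Fin (n - 1) → Finset (Fin n)} (hA : Monotone A)
    (hcard : ∀ i, (A i).card = i + 1) :
    ∃ w : Equiv.Perm (Fin n), ∀ i : Fin (n - 1), prefixSet w (i + 1) = A i := by
  obtain ⟨w, hw⟩ := exists_perm_of_card_eq (A := fun i : Fin (n - 1) => prefixSet 1 (i + 1))
    (fun i j hij x hx => mem_prefixSet.2 ((mem_prefixSet.1 hx).trans_le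
      (by have : (i : ℕ) ≤ j := hij; omega))) hA
    fun i => by rw [card_prefixSet _ (by omega), hcard]
  refine ⟨w, fun i => Finset.ext fun x => ?_⟩
  obtain ⟨x, rfl⟩ := w.surjective x
  rw [apply_mem_prefixSet, hw i, mem_prefixSet]
  rfl

theorem exists_prefixChain_eq (c : Fin (n - 1) ↪o MatchedPair n) :
    ∃ (σ τ : Equiv.Perm (Fin n)) (h : τ 0 = 0), prefixChain σ τ h = c := by
  obtain ⟨τ, hτ⟩ := exists_perm_prefixSet (A := fun i => (c i).1.1)
    (fun i j hij => (c.monotone hij).1) (fun i => size_chain c i)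
  obtain ⟨σ, hσ⟩ := exists_perm_prefixSet (A := fun i => (c i).1.2)
    (fun i j hij => (c.monotone hij).2) (fun i => by rw [(c i).card_snd, size_chain])
  have h : τ 0 = 0 := by
    by_cases hn : n = 1
    · subst hn
      exact Subsingleton.elim _ _
    · have hpos : 0 < n - 1 := by have := NeZero.ne n; omega
      have h0 := (c ⟨0, hpos⟩).2.1
      rw [← hτ ⟨0, hpos⟩, mem_prefixSet] at h0
      have : τ.symm 0 = 0 := Fin.ext (by simpa using h0)
      rw [← this, Equiv.apply_symm_apply, this]
  refine ⟨σ, τ, h, RelEmbedding.ext fun i => Subtype.ext (Prod.ext ?_ ?_)⟩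
  · exact hτ i
  · exact hσ i

/-- Critical chains are counted by pairs of permutations. -/
theorem card_criticalChains :
    (criticalChains (pairInversions (n := n)) (n - 1)).card =
      Nat.card {p : Equiv.Perm (Fin n) × Equiv.Perm (Fin n) // p.2 0 = 0 ∧ des p.1 ⊆ des p.2} := by
  classical
  let F : {p : Equiv.Perm (Fin n) × Equiv.Perm (Fin n) // p.2 0 = 0 ∧ des p.1 ⊆ des p.2} →
      criticalChains (pairInversions (n := n)) (n - 1) := fun p =>
    ⟨chainSet (prefixChain p.1.1 p.1.2 p.2.1), Finset.mem_filter.2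
      ⟨mem_chainSets.2 ⟨isChain_chainSet _, card_chainSet _⟩,
        (toggles_prefixChain_eq_empty _ _ _).2 p.2.2⟩⟩
  have hF : Function.Bijective F := by
    constructor
    · rintro ⟨⟨σ, τ⟩, h⟩ ⟨⟨σ', τ'⟩, h'⟩ heq
      have hc := chainSet_injective (congrArg Subtype.val heq)
      have hτ : τ = τ' := eq_of_prefixSet_eq fun m hm =>
        congrArg (fun q : MatchedPair n => q.1.1) (DFunLike.congr_fun hc (⟨m, hm⟩ : Fin (n - 1)))
      have hσ : σ = σ' := eq_of_prefixSet_eq fun m hm =>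
        congrArg (fun q : MatchedPair n => q.1.2) (DFunLike.congr_fun hc (⟨m, hm⟩ : Fin (n - 1)))
      subst hτ hσ
      rfl
    · rintro ⟨s, hs⟩
      obtain ⟨hs', hcrit⟩ := Finset.mem_filter.1 hs
      obtain ⟨c, rfl⟩ := exists_chainSet_eq (mem_chainSets.1 hs').1 (mem_chainSets.1 hs').2
      obtain ⟨σ, τ, h, rfl⟩ := exists_prefixChain_eq c
      exact ⟨⟨(σ, τ), h, (toggles_prefixChain_eq_empty σ τ h).1 hcrit⟩, rfl⟩
  rw [Nat.card_congr (Equiv.ofBijective F hF), Nat.card_eq_fintype_card, Fintype.card_coe]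

theorem dimXi_eq_card_criticalChains :
    dimXi n = ((criticalChains (pairInversions (n := n)) (n - 1)).card : ℂ) := by
  rw [dimXi_eq_finrank, finrank_reducedHomology_parabolicCosets,
    isInversionSystem_pairInversions.finrank_reducedHomology
      (fun k hk => criticalChains_eq_empty hk) chainSets_eq_empty]

/-- The dimension as an Euler characteristic. -/
theorem dimXi_eq_sum : dimXi n = (((-1) ^ (n - 1) * ∑ k ∈ Finset.range (n - 1 + 1),
    (-1) ^ k * ((chainSets (MatchedPair n) k).card : ℤ) : ℤ) : ℂ) := by
  rw [dimXi_eq_finrank, finrank_reducedHomology_parabolicCosets,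
    ← isInversionSystem_pairInversions.finrank_reducedHomology_eq_sum
      (fun k hk => criticalChains_eq_empty hk) chainSets_eq_empty ℂ, Int.cast_natCast]

end Critical

/-! ### The Euler characteristic of the poset of pairs -/

section EulerCharacteristic

open Classical in
/-- The chains in `D`. -/
noncomputable def chainsIn {α : Type*} [PartialOrder α] (D : Finset α) : Finset (Finset α) :=
  D.powerset.filter fun c : Finset α => IsChain (· ≤ ·) (c : Set α)

theorem mem_chainsIn {α : Type*} [PartialOrder α] {D c : Finset α} :
    c ∈ chainsIn D ↔ c ⊆ D ∧ IsChain (· ≤ ·) (c : Set α) := by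
  simp [chainsIn]

/-- The reduced Euler characteristic, up to sign, of the order complex of `D`: the signed number of
chains in `D`. -/
noncomputable def chainSum {α : Type*} [PartialOrder α] (D : Finset α) : ℤ :=
  ∑ c ∈ chainsIn D, (-1) ^ c.card

open Classical in
/-- Nonempty chains are classified by their maximum. -/
theorem chainSum_eq {α : Type*} [PartialOrder α] (D : Finset α) :
    chainSum D = 1 - ∑ q ∈ D, chainSum (D.filter (· < q)) := by
  have hmax : ∀ c ∈ chainsIn D, c ≠ ∅ →
      ((-1 : ℤ) ^ c.card) =
        ∑ q ∈ D, if q ∈ c ∧ ∀ p ∈ c, p ≤ q then (-1 : ℤ) ^ c.card else 0 := by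
    intro c hc hne
    obtain ⟨hcD, hc⟩ := mem_chainsIn.1 hc
    obtain ⟨q, hq⟩ := c.exists_maximal (Finset.nonempty_iff_ne_empty.2 hne)
    have hqmax : ∀ p ∈ c, p ≤ q := fun p hp => by
      by_contra h
      obtain h' | h' := hc hp hq.1 fun h' => h h'.le
      · exact h h'
      · exact h (hq.2 hp h')
    rw [Finset.sum_eq_single q]
    · rw [if_pos ⟨hq.1, hqmax⟩]
    · rintro p - hpq
      exact if_neg fun h => hpq (le_antisymm (hqmax p h.1) (h.2 q hq.1))
    · exact fun h => absurd (hcD hq.1) h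
  have hfiber : ∀ q ∈ D,
      (∑ c ∈ (chainsIn D).erase ∅,
        if q ∈ c ∧ ∀ p ∈ c, p ≤ q then (-1 : ℤ) ^ c.card else 0) =
          -chainSum (D.filter (· < q)) := by
    intro q hqD
    rw [← Finset.sum_filter, chainSum, ← Finset.sum_neg_distrib]
    refine Finset.sum_bij' (fun c _ => c.erase q) (fun c _ => insert q c) ?_ ?_ ?_ ?_ ?_
    · intro c hc
      simp only [Finset.mem_filter, Finset.mem_erase, mem_chainsIn] at hc ⊢
      obtain ⟨⟨-, hcD, hc⟩, -, hmax⟩ := hc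
      refine ⟨fun p hp => ?_, hc.mono (by simp)⟩
      obtain ⟨hpq, hp⟩ := Finset.mem_erase.1 hp
      exact Finset.mem_filter.2 ⟨hcD hp, lt_of_le_of_ne (hmax p hp) hpq⟩
    · intro c hc
      simp only [Finset.mem_filter, Finset.mem_erase, mem_chainsIn] at hc ⊢
      obtain ⟨hcD, hc⟩ := hc
      have hlt : ∀ p ∈ c, p < q := fun p hp => (Finset.mem_filter.1 (hcD hp)).2
      refine ⟨⟨Finset.insert_ne_empty _ _, Finset.insert_subset hqD fun p hp =>
        (Finset.mem_filter.1 (hcD hp)).1, ?_⟩, Finset.mem_insert_self _ _, fun p hp => ?_⟩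
      · rw [Finset.coe_insert]
        exact hc.insert fun p hp _ => Or.inr (hlt p hp).le
      · obtain rfl | hp := Finset.mem_insert.1 hp
        · exact le_rfl
        · exact (hlt p hp).le
    · intro c hc
      simp only [Finset.mem_filter] at hc
      exact Finset.insert_erase hc.2.1
    · intro c hc
      rw [mem_chainsIn] at hc
      exact Finset.erase_insert fun h => (Finset.mem_filter.1 (hc.1 h)).2.ne rfl
    · intro c hc
      simp only [Finset.mem_filter] at hc
      conv_lhs => rw [← Finset.card_erase_add_one hc.2.1, pow_succ]
      ring
  have hempty : (∅ : Finset α) ∈ chainsIn D := by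
    simp [mem_chainsIn]
  rw [chainSum, ← Finset.add_sum_erase _ _ hempty, Finset.sum_congr rfl fun c hc =>
    hmax c (Finset.mem_of_mem_erase hc) (Finset.ne_of_mem_erase hc), Finset.sum_comm,
    Finset.sum_congr rfl hfiber, Finset.sum_neg_distrib]
  simp [sub_eq_add_neg]

/-- The numbers `e m` with `∑ j ≤ m, (m choose j) (m + 1 choose j + 1) e j = 1`, which turn out to
be the signed numbers of chains in `MatchedPair (m + 1)`. -/
def eulerNumber (m : ℕ) : ℤ :=
  1 - ∑ j : Fin m, (m.choose j * (m + 1).choose (j + 1) : ℤ) * eulerNumber j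
termination_by m
decreasing_by exact j.2

theorem sum_choose_mul_eulerNumber (m : ℕ) : ∑ j ∈ Finset.range (m + 1),
    (m.choose j * (m + 1).choose (j + 1) : ℤ) * eulerNumber j = 1 := by
  rw [Finset.sum_range_succ, eulerNumber.eq_1 m, Finset.sum_range]
  simp

variable {n : ℕ} [NeZero n]

open Classical in
/-- The pairs contained in `(A, B)`, and smaller in size. -/
noncomputable def pairsBelow (A B : Finset (Fin n)) : Finset (MatchedPair n) :=
  Finset.univ.filter fun q => q.1.1 ⊆ A ∧ q.1.2 ⊆ B ∧ q.size < A.card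

theorem mem_pairsBelow {A B : Finset (Fin n)} {q : MatchedPair n} :
    q ∈ pairsBelow A B ↔ q.1.1 ⊆ A ∧ q.1.2 ⊆ B ∧ q.size < A.card := by
  simp [pairsBelow]

open Classical in
theorem card_pairsBelow_size_eq {A B : Finset (Fin n)} {m : ℕ} (hA : A.card = m + 1)
    (hB : B.card = m + 1) (h0 : 0 ∈ A) {j : ℕ} (hj : j < m) :
    ((pairsBelow A B).filter fun q => q.size = j + 1).card =
      m.choose j * (m + 1).choose (j + 1) := by
  have hA' : (A.erase 0).card = m := by rw [Finset.card_erase_of_mem h0, hA]; rfl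
  have h1 := Finset.card_powersetCard j (A.erase 0)
  have h2 := Finset.card_powersetCard (j + 1) B
  rw [hA'] at h1
  rw [hB] at h2
  rw [← h1, ← h2, ← Finset.card_product]
  refine Finset.card_bij (fun q _ => (q.1.1.erase 0, q.1.2)) ?_ ?_ ?_
  · intro q hq
    obtain ⟨hq, hsize⟩ := Finset.mem_filter.1 hq
    obtain ⟨hqA, hqB, -⟩ := mem_pairsBelow.1 hq
    refine Finset.mem_product.2 ⟨Finset.mem_powersetCard.2
      ⟨Finset.erase_subset_erase _ hqA, ?_⟩, Finset.mem_powersetCard.2 ⟨hqB, ?_⟩⟩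
    · rw [Finset.card_erase_of_mem q.2.1, q.card_fst, hsize]
      rfl
    · rw [q.card_snd, hsize]
  · intro p _ q _ h
    have h1 : p.1.1.erase 0 = q.1.1.erase 0 := congrArg Prod.fst h
    have h2 : p.1.2 = q.1.2 := (Prod.ext_iff.1 h).2
    refine Subtype.ext (Prod.ext ?_ h2)
    rw [← Finset.insert_erase p.2.1, h1, Finset.insert_erase q.2.1]
  · rintro ⟨A', B'⟩ h
    obtain ⟨hA1, hB1⟩ := Finset.mem_product.1 h
    obtain ⟨hA1, hA2⟩ := Finset.mem_powersetCard.1 hA1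
    obtain ⟨hB1, hB2⟩ := Finset.mem_powersetCard.1 hB1
    have h0' : (0 : Fin n) ∉ A' := fun h => Finset.notMem_erase _ _ (hA1 h)
    have hcard : (insert 0 A').card = j + 1 := by
      rw [Finset.card_insert_of_notMem h0']
      exact congrArg (· + 1) hA2
    have hn : A.card ≤ n := by simpa using Finset.card_le_univ A
    refine ⟨⟨(insert 0 A', B'), Finset.mem_insert_self _ _, fun h => ?_, hcard.trans hB2.symm⟩,
      Finset.mem_filter.2 ⟨mem_pairsBelow.2 ⟨?_, hB1, ?_⟩, hcard⟩, ?_⟩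
    · have h : insert 0 A' = Finset.univ := h
      rw [h, Finset.card_univ, Fintype.card_fin] at hcard
      omega
    · exact Finset.insert_subset h0 (hA1.trans (Finset.erase_subset _ _))
    · rw [MatchedPair.size, hcard, hA]
      omega
    · exact Prod.ext (Finset.erase_insert h0') rfl

/-- The pairs below a given one are again of the form `pairsBelow A B`, so that the classification
of chains by their maximum gives the recursion which defines `eulerNumber`. -/
theorem chainSum_pairsBelow {A B : Finset (Fin n)} {m : ℕ} (hA : A.card = m + 1)
    (hB : B.card = m + 1) (h0 : 0 ∈ A) : chainSum (pairsBelow A B) = eulerNumber m := by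
  classical
  induction m using Nat.strong_induction_on generalizing A B with
  | _ m ih =>
    have hlow : ∀ q ∈ pairsBelow A B, (pairsBelow A B).filter (· < q) =
        pairsBelow q.1.1 q.1.2 := by
      intro q hq
      obtain ⟨hqA, hqB, hsize⟩ := mem_pairsBelow.1 hq
      ext p
      rw [Finset.mem_filter, mem_pairsBelow, mem_pairsBelow, q.card_fst]
      constructor
      · rintro ⟨-, h⟩
        exact ⟨h.le.1, h.le.2, MatchedPair.size_strictMono h⟩
      · rintro ⟨h1, h2, h3⟩
        refine ⟨⟨h1.trans hqA, h2.trans hqB, h3.trans hsize⟩, lt_of_le_of_ne ⟨h1, h2⟩ ?_⟩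
        rintro rfl
        exact h3.ne rfl
    have hterm : ∀ q ∈ pairsBelow A B, chainSum ((pairsBelow A B).filter (· < q)) =
        eulerNumber (q.size - 1) := by
      intro q hq
      have h1 := q.size_pos
      have h2 := (mem_pairsBelow.1 hq).2.2
      rw [hlow q hq]
      exact ih _ (by omega) (by rw [q.card_fst]; omega) (by rw [q.card_snd]; omega) q.2.1
    have hmaps : ∀ q ∈ pairsBelow A B, q.size - 1 ∈ Finset.range m := fun q hq => by
      have h1 := q.size_pos
      have h2 := (mem_pairsBelow.1 hq).2.2
      exact Finset.mem_range.2 (by omega)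
    rw [chainSum_eq, Finset.sum_congr rfl hterm, ← Finset.sum_fiberwise_of_maps_to hmaps,
      eulerNumber.eq_1 m, Finset.sum_range]
    congr 1
    refine Finset.sum_congr rfl fun j _ => ?_
    have hfilter : (pairsBelow A B).filter (fun q => q.size - 1 = (j : ℕ)) =
        (pairsBelow A B).filter fun q => q.size = (j : ℕ) + 1 := Finset.filter_congr fun q _ => by
      have h1 := q.size_pos
      omega
    rw [Finset.sum_congr rfl fun q hq => by rw [(Finset.mem_filter.1 hq).2], Finset.sum_const,
      hfilter, card_pairsBelow_size_eq hA hB h0 j.2, nsmul_eq_mul]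
    push_cast
    ring

theorem sum_card_chainSets : ∑ k ∈ Finset.range (n - 1 + 1),
    (-1) ^ k * ((chainSets (MatchedPair n) k).card : ℤ) = eulerNumber (n - 1) := by
  classical
  have hn := NeZero.pos n
  have hcard : (Finset.univ : Finset (Fin n)).card = n - 1 + 1 := by simp; omega
  have huniv : pairsBelow (Finset.univ : Finset (Fin n)) Finset.univ = Finset.univ :=
    Finset.eq_univ_of_forall fun q => mem_pairsBelow.2
      ⟨Finset.subset_univ _, Finset.subset_univ _, by
        rw [Finset.card_univ, Fintype.card_fin]; exact q.size_lt⟩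
  rw [← chainSum_pairsBelow hcard hcard (Finset.mem_univ 0), huniv, chainSum]
  have hmaps : ∀ c ∈ chainsIn (Finset.univ : Finset (MatchedPair n)),
      c.card ∈ Finset.range (n - 1 + 1) := by
    intro c hc
    have := Finset.card_le_card (image_size_subset c)
    rw [Finset.card_image_of_injOn (size_injOn_of_isChain (mem_chainsIn.1 hc).2),
      Nat.card_Icc] at this
    exact Finset.mem_range.2 (by omega)
  rw [← Finset.sum_fiberwise_of_maps_to hmaps]
  refine Finset.sum_congr rfl fun k _ => ?_
  rw [Finset.sum_congr rfl fun c hc => by rw [(Finset.mem_filter.1 hc).2], Finset.sum_const,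
    nsmul_eq_mul, mul_comm]
  congr 3
  ext c
  simp [mem_chainSets, mem_chainsIn]

theorem dimXi_eq_eulerNumber : dimXi n = (-1) ^ (n - 1) * (eulerNumber (n - 1) : ℂ) := by
  rw [dimXi_eq_sum, sum_card_chainSets]
  push_cast
  rfl

end EulerCharacteristic

/-! ### The generating function -/

section GeneratingFunction

open PowerSeries

/-- The formal logarithm has the logarithmic derivative as its derivative. -/
theorem mul_derivative_logOf {f : PowerSeries ℂ} (hf : constantCoeff f = 1) :
    f * d⁄dX ℂ (logOf f) = d⁄dX ℂ f := by
  have hs : HasSubst (f - 1) := HasSubst.of_constantCoeff_zero' (by simp [hf])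
  have hgeom : d⁄dX ℂ (log ℂ) * (1 + X) = 1 := by
    rw [deriv_log]
    ext n
    rw [mul_add, mul_one, map_add, coeff_mk]
    cases n with
    | zero => simp
    | succ n =>
      rw [coeff_succ_mul_X, coeff_mk, coeff_one, if_neg (Nat.succ_ne_zero n)]
      simp [pow_succ]
  have hsubst := congrArg (substAlgHom (R := ℂ) hs) hgeom
  rw [map_mul, map_add, map_one, substAlgHom_X, coe_substAlgHom, add_sub_cancel] at hsubst
  rw [logOf_eq, derivative_subst hs, map_sub, derivative_one, sub_zero, ← mul_assoc, mul_comm f,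
    hsubst, one_mul]

theorem bessel_mul_derivative_dimSeries :
    besselJZeroTwoSqrt * d⁄dX ℂ dimSeries = -d⁄dX ℂ besselJZeroTwoSqrt := by
  ext n
  rw [coeff_mul, map_neg, coeff_derivative, ← Finset.Nat.sum_antidiagonal_swap,
    Finset.Nat.sum_antidiagonal_eq_sum_range_succ_mk]
  have hterm : ∀ j ∈ Finset.range (n + 1),
      coeff (n - j) besselJZeroTwoSqrt * coeff j (d⁄dX ℂ dimSeries) =
        (-1) ^ n / (n ! * (n + 1)! : ℂ) *
          (n.choose j * (n + 1).choose (j + 1) * eulerNumber j) := by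
    intro j hj
    obtain ⟨i, rfl⟩ := Nat.exists_eq_add_of_le (Nat.lt_succ_iff.1 (Finset.mem_range.1 hj))
    have h1 : ((j + i).choose j : ℂ) = (j + i)! / (j ! * i !) := by
      rw [Nat.cast_add_choose]
    have h2 : ((j + i + 1).choose (j + 1) : ℂ) = (j + i + 1)! / ((j + 1)! * i !) := by
      rw [add_right_comm, Nat.cast_add_choose]
    rw [coeff_derivative, dimSeries, besselJZeroTwoSqrt, coeff_mk, coeff_mk,
      if_neg (Nat.succ_ne_zero j), dimXi_eq_eulerNumber, Nat.add_sub_cancel_left,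
      Nat.add_sub_cancel, h1, h2, Nat.factorial_succ j, pow_add]
    have f1 : ((j + i)! : ℂ) ≠ 0 := Nat.cast_ne_zero.2 (Nat.factorial_ne_zero _)
    have f2 : ((j + i + 1)! : ℂ) ≠ 0 := Nat.cast_ne_zero.2 (Nat.factorial_ne_zero _)
    have f3 : (j ! : ℂ) ≠ 0 := Nat.cast_ne_zero.2 (Nat.factorial_ne_zero _)
    have f4 : (i ! : ℂ) ≠ 0 := Nat.cast_ne_zero.2 (Nat.factorial_ne_zero _)
    have f5 : (j : ℂ) + 1 ≠ 0 := Nat.cast_add_one_ne_zero j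
    push_cast
    field_simp
  have hsum := congrArg (Int.cast : ℤ → ℂ) (sum_choose_mul_eulerNumber n)
  push_cast at hsum
  simp only [Prod.swap_prod_mk]
  rw [Finset.sum_congr rfl hterm, ← Finset.mul_sum, hsum, besselJZeroTwoSqrt, coeff_mk,
    Nat.factorial_succ]
  have f1 : (n ! : ℂ) ≠ 0 := Nat.cast_ne_zero.2 (Nat.factorial_ne_zero _)
  have f2 : (n : ℂ) + 1 ≠ 0 := Nat.cast_add_one_ne_zero n
  push_cast
  field_simp
  ring

theorem dimSeries_eq : dimSeries = -logOf besselJZeroTwoSqrt := by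
  have hJ : constantCoeff besselJZeroTwoSqrt = 1 := by
    rw [← coeff_zero_eq_constantCoeff_apply, besselJZeroTwoSqrt, coeff_mk]
    simp
  have hne : besselJZeroTwoSqrt ≠ 0 := fun h => by simp [h] at hJ
  refine derivative.ext (mul_left_cancel₀ hne ?_) ?_
  · rw [bessel_mul_derivative_dimSeries, map_neg, mul_neg, mul_derivative_logOf hJ]
  · rw [map_neg, constantCoeff_logOf hJ, ← coeff_zero_eq_constantCoeff_apply, dimSeries, coeff_mk]
    simp

end GeneratingFunction
end ParabolicCosets

theorem mainTheorem8 :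
    (∀ (n : ℕ) [NeZero n],
      ParabolicCosets.dimXi n =
        (Nat.card {p : Equiv.Perm (Fin n) × Equiv.Perm (Fin n) //
          p.2 0 = 0 ∧ ParabolicCosets.des p.1 ⊆ ParabolicCosets.des p.2} : ℂ)) ∧
    ParabolicCosets.dimSeries = -PowerSeries.logOf ParabolicCosets.besselJZeroTwoSqrt := by
  refine ⟨fun n _ => ?_, ParabolicCosets.dimSeries_eq⟩
  rw [ParabolicCosets.dimXi_eq_card_criticalChains, ParabolicCosets.card_criticalChains]
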